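/- **Setting.** Let $d\ge 1$ and let $\Omega\subset\mathbb R^d$ be nonempty, open and bounded; $\Omega^c=\mathbb R^d\setminus\Omega$. Let $\nu:\mathbb R^d\setminus\{0\}\to[0,\infty]$ be the density of a symmetric Lévy measure, i.e. measurable with $\nu(h)=\nu(-h)$ and $\int_{\mathbb R^d}(1\wedge|h|^2)\,\nu(h)\,dh<\infty$, and assume that the measure $\nu(h)\,dh$ has full support ($=\mathbb R^d$). Put - $V_\nu(\Omega|\mathbb R^d)=\{u:\mathbb R^d\to\mathbb R\text{ measurable}:\ \|u\|_V^2:=\int_\Omega u^2\,dx+\int_\Omega\int_{\mathbb R^d}(u(x)-u(y))^2\nu(x-y)\,dy\,dx<\infty\}$, and $V_\nu(\Omega|\mathbb R^d)^\perp=\{u\in V_\nu(\Omega|\mathbb R^d):\int_\Omega u=0\}$ (functions equal a.e. are identified); - $H_\nu(\Omega)=\{u:\Omega\to\mathbb R\text{ measurable}:\ \|u\|_{H_\nu(\Omega)}^2:=\int_\Omega u^2\,dx+\int_\Omega\int_\Omega(u(x)-u(y))^2\nu(x-y)\,dy\,dx<\infty\}$; - $T_\nu(\Omega^c)=\{u|_{\Omega^c}:u\in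 V_\nu(\Omega|\mathbb R^d)\}$ with norm $\|v\|_T=\inf\{\|u\|_V:\ u\in V_\nu(\Omega|\mathbb R^d),\ u|_{\Omega^c}=v\}$; - $\widetilde\nu(x)=\int_B(1\wedge\nu(x-y))\,dy$ for a nonempty open set $B\subset\Omega$, and $\|g\|_{L^2(\Omega^c,\widetilde\nu^{-1})}^2=\int_{\Omega^c}g^2\,\widetilde\nu^{-1}\,dx$. Assume that $(\nu,\Omega)$ belongs to one of the following classes: - $\mathscr A_0$: $\nu$ is unimodal, i.e. radial, with $\nu(r)\le c\,\nu(s)$ for all $0<s\le r$ and some $c\ge1$, and has full support; - $\mathscr A_1$: $\int_{\mathbb R^d}\nu=\infty$ and there are $E:H_\nu(\Omega)\to H_\nu(\mathbb R^d)$ and $C$ with $Eu|_\Omega=u$ and $\|Eu\|_{H_\nu(\mathbb R^d)}\le C\|u\|_{H_\nu(\Omega)}$ for all $u$; - $\mathscr A_2$: $\int_{\mathbb R^d}\nu=\infty$, $\partial\Omega$ is Lipschitz, $\nu$ is radial, and $\delta^{-2}\int_{B_\delta(0)}|h|^2\nu(h)\,dh\to\infty$ as $\delta\to0^+$; - $\mathscr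 A_3$: $\int_{\mathbb R^d}\nu=\infty$ and $\inf_{a\in\partial\Omega}\int_{\Omega_\delta}\nu(h-a)\,dh\to\infty$ as $\delta\to0^+$, where $\Omega_\delta=\{x\in\Omega:\operatorname{dist}(x,\partial\Omega)>\delta\}$. Let $\Lambda\ge1$, and let $k:\mathbb R^d\times\mathbb R^d\setminus\operatorname{diag}\to[0,\infty)$ be measurable and symmetric with $\Lambda^{-1}\nu(y-x)\le k(x,y)\le\Lambda\,\nu(y-x)$ for all $x\ne y$. Put $$\mathcal E(u,v)=\tfrac12\iint_{(\Omega^c\times\Omega^c)^c}(u(x)-u(y))(v(x)-v(y))\,k(x,y)\,dx\,dy .$$ **Theorem.** There is a constant $C>0$ depending only on $d,\Omega,\Lambda,\nu$ (not on $k$, $B$ or the data) such that the following holds; in particular all integrals below converge absolutely. *(A) Dual data.* Let $f\in V_\nu(\Omega|\mathbb R^d)'$ and $g\in T_\nu(\Omega^c)'$. (i) There is a unique $u\in V_\nu(\Omega|\mathbb R^d)^\perp$ with $\mathcal E(u,v)=\langle f,v\rangle+\langle g,v|_{\Omega^c}\rangle$ for all $v\in V_\nu(\Omega|\mathbb R^d)^\perp$,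 and $\|u\|_V\le C(\|f\|_{V'}+\|g\|_{T'})$. (ii) The problem of finding $w\in V_\nu(\Omega|\mathbb R^d)$ with $\mathcal E(w,v)=\langle f,v\rangle+\langle g,v|_{\Omega^c}\rangle$ for all $v\in V_\nu(\Omega|\mathbb R^d)$ is solvable if and only if $\langle f,1\rangle+\langle g,1\rangle=0$. In this case its solutions are exactly the functions $w=u+c$, $c\in\mathbb R$, with $u$ from (i). Every solution satisfies $\|w-|\Omega|^{-1}\int_\Omega w\|_V\le C(\|f\|_{V'}+\|g\|_{T'})$. *(B) Function data.* Let $f\in L^2(\Omega)$ and $g\in L^2(\Omega^c,\widetilde\nu^{-1})$. (i) There is a unique $u\in V_\nu(\Omega|\mathbb R^d)^\perp$ with $\mathcal E(u,v)=\int_\Omega fv\,dx+\int_{\Omega^c}gv\,dy$ for all $v\in V_\nu(\Omega|\mathbb R^d)^\perp$, and $\|u\|_V\le C(\|f\|_{L^2(\Omega)}+\|g\|_{L^2(\Omega^c,\widetilde\nu^{-1})})$. (ii) The problem of finding $w\in V_\nu(\Omega|\mathbb R^d)$ with $\mathcal E(w,v)=\int_\Omega fv\,dx+\int_{\Omega^c}gv\,dy$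 for all $v\in V_\nu(\Omega|\mathbb R^d)$ is solvable if and only if $\int_\Omega f\,dx+\int_{\Omega^c}g\,dy=0$. In this case its solutions are exactly the functions $w=u+c$, $c\in\mathbb R$, with $u$ from (i). Every solution satisfies $\|w-|\Omega|^{-1}\int_\Omega w\|_V\le C(\|f\|_{L^2(\Omega)}+\|g\|_{L^2(\Omega^c,\widetilde\nu^{-1})})$. -/

import Mathlib

open MeasureTheory Set Filter Topology
open scoped ENNReal NNReal

noncomputable section

namespace NonlocalNeumann

/-- The Euclidean space `ℝ^d`. -/
abbrev Rd (d : ℕ) : Type := EuclideanSpace ℝ (Fin d)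

/-! ### Lévy densities -/

/-- The density `ν` of a symmetric Lévy measure on `ℝ^d`:
`ν (-h) = ν h` and `∫ (1 ∧ |h|²) ν(h) dh < ∞`. (The value at the null set `{0}` is irrelevant
for `1 ≤ d`.) -/
structure LevyDensity (d : ℕ) where
  toFun : Rd d → ℝ≥0∞
  measurable' : Measurable toFun
  symm' : ∀ h, toFun (-h) = toFun h
  levy' : ∫⁻ h, ENNReal.ofReal (min 1 (‖h‖ ^ 2)) * toFun h < ∞

variable {d : ℕ}

instance : CoeFun (LevyDensity d) (fun _ => Rd d → ℝ≥0∞) := ⟨LevyDensity.toFun⟩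

/-- The Lévy measure `ν(h) dh` has full support, i.e. its topological support is `ℝ^d`. -/
def LevyDensity.HasFullSupport (ν : LevyDensity d) : Prop :=
  ((volume : Measure (Rd d)).withDensity ν).support = univ

/-- `ν` is radial: `ν h` depends only on `|h|` (for `h ≠ 0`). -/
def LevyDensity.IsRadial (ν : LevyDensity d) : Prop :=
  ∃ φ : ℝ → ℝ≥0∞, ∀ h : Rd d, h ≠ 0 → ν h = φ ‖h‖

/-- `ν` is unimodal: it is radial with an almost decreasing profile. -/
def LevyDensity.IsUnimodal (ν : LevyDensity d) : Prop :=
  ∃ φ : ℝ → ℝ≥0∞, (∀ h : Rd d, h ≠ 0 → ν h = φ ‖h‖) ∧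
    ∃ c : ℝ≥0, 1 ≤ c ∧ ∀ r s : ℝ, 0 < s → s ≤ r → φ r ≤ c * φ s

/-- The weight `ν̃(x) = ∫_B (1 ∧ ν(x - y)) dy`. -/
def LevyDensity.tilde (ν : LevyDensity d) (B : Set (Rd d)) (x : Rd d) : ℝ≥0∞ :=
  ∫⁻ y in B, min 1 (ν (x - y))

/-! ### The function spaces `V_ν(Ω|A)` -/

/-- `∫_Ω u(x)² dx + ∫_Ω ∫_A (u(x) - u(y))² ν(x - y) dy dx`. -/
def sqNorm (ν : LevyDensity d) (Ω A : Set (Rd d)) (u : Rd d → ℝ) : ℝ≥0∞ :=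
  (∫⁻ x in Ω, ENNReal.ofReal (u x ^ 2)) +
    ∫⁻ p in Ω ×ˢ A, ENNReal.ofReal ((u p.1 - u p.2) ^ 2) * ν (p.1 - p.2)

/-- The measure `ν(x - y) dx dy` on `Ω × A`. -/
def jumpMeasure (ν : LevyDensity d) (Ω A : Set (Rd d)) : Measure (Rd d × Rd d) :=
  ((volume : Measure (Rd d × Rd d)).restrict (Ω ×ˢ A)).withDensity fun p => ν (p.1 - p.2)

theorem eLpNorm_two_sq {α : Type*} [MeasurableSpace α] (μ : Measure α) (u : α → ℝ) :
    eLpNorm u 2 μ ^ 2 = ∫⁻ x, ENNReal.ofReal (u x ^ 2) ∂μ := by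
  have h := eLpNorm_nnreal_pow_eq_lintegral (f := u) (μ := μ) (p := 2) (by norm_num)
  simp only [NNReal.coe_ofNat, ENNReal.coe_ofNat, ENNReal.rpow_ofNat] at h
  rw [h]
  refine lintegral_congr fun x => ?_
  rw [Real.enorm_eq_ofReal_abs, ← ENNReal.ofReal_pow (abs_nonneg _), sq_abs]

theorem sqNorm_eq (ν : LevyDensity d) (Ω A : Set (Rd d)) {u : Rd d → ℝ} (hu : Measurable u) :
    sqNorm ν Ω A u = eLpNorm u 2 (volume.restrict Ω) ^ 2 +
      eLpNorm (fun p : Rd d × Rd d => u p.1 - u p.2) 2 (jumpMeasure ν Ω A) ^ 2 := by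
  rw [eLpNorm_two_sq, eLpNorm_two_sq, sqNorm, jumpMeasure,
    lintegral_withDensity_eq_lintegral_mul]
  · simp only [Pi.mul_apply, mul_comm]
  · exact ν.measurable'.comp (measurable_fst.sub measurable_snd)
  · exact (((hu.comp measurable_fst).sub (hu.comp measurable_snd)).pow_const 2).ennreal_ofReal

theorem sqNorm_lt_top_iff (ν : LevyDensity d) (Ω A : Set (Rd d)) {u : Rd d → ℝ}
    (hu : Measurable u) :
    sqNorm ν Ω A u < ∞ ↔ MemLp u 2 (volume.restrict Ω) ∧
      MemLp (fun p : Rd d × Rd d => u p.1 - u p.2) 2 (jumpMeasure ν Ω A) := by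
  have h2 : Measurable (fun p : Rd d × Rd d => u p.1 - u p.2) :=
    (hu.comp measurable_fst).sub (hu.comp measurable_snd)
  rw [sqNorm_eq ν Ω A hu, ENNReal.add_lt_top]
  simp [MemLp, hu.aestronglyMeasurable, h2.aestronglyMeasurable, ENNReal.pow_lt_top_iff]

/-- The vector space of all measurable `u : ℝ^d → ℝ` with `u|_Ω ∈ L²(Ω)` and
`∫_Ω ∫_A (u(x) - u(y))² ν(x - y) dy dx < ∞`. -/
def spaceSubmodule (ν : LevyDensity d) (Ω A : Set (Rd d)) : Submodule ℝ (Rd d → ℝ) where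
  carrier := {u | Measurable u ∧ sqNorm ν Ω A u < ∞}
  zero_mem' := ⟨measurable_const, by simp [sqNorm]⟩
  add_mem' := by
    rintro u v ⟨hu, hu'⟩ ⟨hv, hv'⟩
    refine ⟨hu.add hv, ?_⟩
    rw [sqNorm_lt_top_iff ν Ω A hu] at hu'
    rw [sqNorm_lt_top_iff ν Ω A hv] at hv'
    rw [sqNorm_lt_top_iff ν Ω A (hu.add hv)]
    refine ⟨hu'.1.add hv'.1, (hu'.2.add hv'.2).ae_eq (ae_of_all _ fun p => ?_)⟩
    simp only [Pi.add_apply]; ring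
  smul_mem' := by
    rintro c u ⟨hu, hu'⟩
    refine ⟨hu.const_smul c, ?_⟩
    rw [sqNorm_lt_top_iff ν Ω A hu] at hu'
    rw [sqNorm_lt_top_iff ν Ω A (hu.const_smul c)]
    refine ⟨hu'.1.const_smul c, (hu'.2.const_smul c).ae_eq (ae_of_all _ fun p => ?_)⟩
    simp only [Pi.smul_apply, smul_eq_mul]; ring

/-- The space `V_ν(Ω|A)`, as a seminormed space of measurable functions; functions that agree
almost everywhere are not identified. -/
def VSpace (ν : LevyDensity d) (Ω A : Set (Rd d)) : Type := spaceSubmodule ν Ω A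

/-- The energy space `V_ν(Ω|ℝ^d)`. -/
abbrev V (ν : LevyDensity d) (Ω : Set (Rd d)) : Type := VSpace ν Ω univ

/-- The space `H_ν(Ω)`, with `‖u‖² = ∫_Ω u² + ∫_Ω ∫_Ω (u(x) - u(y))² ν(x - y) dy dx`. Its
elements are represented by measurable functions on `ℝ^d`, whose values off `Ω` play no role. -/
abbrev H (ν : LevyDensity d) (Ω : Set (Rd d)) : Type := VSpace ν Ω Ω

section Instances

variable {ν : LevyDensity d} {Ω A : Set (Rd d)}

instance : AddCommGroup (VSpace ν Ω A) := inferInstanceAs (AddCommGroup (spaceSubmodule ν Ω A))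

instance : Module ℝ (VSpace ν Ω A) := inferInstanceAs (Module ℝ (spaceSubmodule ν Ω A))

instance : CoeFun (VSpace ν Ω A) (fun _ => Rd d → ℝ) := ⟨Subtype.val⟩

theorem VSpace.measurable (u : VSpace ν Ω A) : Measurable u := u.2.1

/-- `‖u‖² = ∫_Ω u² + ∫_Ω ∫_A (u(x) - u(y))² ν(x - y) dy dx`. -/
instance : Norm (VSpace ν Ω A) := ⟨fun u => √(sqNorm ν Ω A u).toReal⟩

theorem VSpace.norm_def (u : VSpace ν Ω A) : ‖u‖ = √(sqNorm ν Ω A u).toReal := rfl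

theorem VSpace.memLp (u : VSpace ν Ω A) : MemLp u 2 ((volume : Measure (Rd d)).restrict Ω) :=
  ((sqNorm_lt_top_iff ν Ω A u.2.1).1 u.2.2).1

theorem VSpace.memLp_jump (u : VSpace ν Ω A) :
    MemLp (fun p : Rd d × Rd d => u p.1 - u p.2) 2 (jumpMeasure ν Ω A) :=
  ((sqNorm_lt_top_iff ν Ω A u.2.1).1 u.2.2).2

/-- The map `u ↦ (u|_Ω, u(x) - u(y))` into `L²(Ω) × L²(ν(x - y) dx dy)`. -/
def VSpace.toL2 (u : VSpace ν Ω A) :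
    WithLp 2 (Lp ℝ 2 ((volume : Measure (Rd d)).restrict Ω) × Lp ℝ 2 (jumpMeasure ν Ω A)) :=
  WithLp.toLp 2 (u.memLp.toLp u, u.memLp_jump.toLp fun p : Rd d × Rd d => u p.1 - u p.2)

theorem VSpace.norm_toL2 (u : VSpace ν Ω A) : ‖u.toL2‖ = ‖u‖ := by
  rw [WithLp.prod_norm_eq_of_L2, VSpace.norm_def, sqNorm_eq ν Ω A u.2.1,
    ENNReal.toReal_add (ENNReal.pow_ne_top u.memLp.2.ne) (ENNReal.pow_ne_top u.memLp_jump.2.ne)]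
  simp only [VSpace.toL2, ENNReal.toReal_pow]
  rw [← Lp.norm_toLp _ u.memLp, ← Lp.norm_toLp _ u.memLp_jump]
  rfl

theorem VSpace.toL2_add (u v : VSpace ν Ω A) : (u + v).toL2 = u.toL2 + v.toL2 := by
  refine WithLp.ofLp_injective 2 (Prod.ext rfl ?_)
  have h : (u + v).memLp_jump.toLp _ = (u.memLp_jump.add v.memLp_jump).toLp _ := by
    refine MemLp.toLp_congr _ _ (ae_of_all _ fun p => ?_)
    change (u p.1 + v p.1) - (u p.2 + v p.2) = (u p.1 - u p.2) + (v p.1 - v p.2)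
    ring
  exact h

theorem VSpace.toL2_smul (c : ℝ) (u : VSpace ν Ω A) : (c • u).toL2 = c • u.toL2 := by
  refine WithLp.ofLp_injective 2 (Prod.ext rfl ?_)
  have h : (c • u).memLp_jump.toLp _ = (u.memLp_jump.const_smul c).toLp _ := by
    refine MemLp.toLp_congr _ _ (ae_of_all _ fun p => ?_)
    change c * u p.1 - c * u p.2 = c * (u p.1 - u p.2)
    ring
  exact h

theorem VSpace.core : SeminormedSpace.Core ℝ (VSpace ν Ω A) where
  norm_nonneg u := Real.sqrt_nonneg _
  norm_smul c u := by
    rw [← VSpace.norm_toL2, ← VSpace.norm_toL2, VSpace.toL2_smul, norm_smul]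
  norm_triangle u v := by
    rw [← VSpace.norm_toL2, ← VSpace.norm_toL2 u, ← VSpace.norm_toL2 v, VSpace.toL2_add]
    exact norm_add_le _ _

instance : SeminormedAddCommGroup (VSpace ν Ω A) := SeminormedAddCommGroup.ofCore VSpace.core

instance : NormedSpace ℝ (VSpace ν Ω A) where
  norm_smul_le c u := (VSpace.core.norm_smul c u).le

end Instances

/-- The constant function `c`, as an element of `V_ν(Ω|ℝ^d)` for bounded `Ω`. -/
def constV (ν : LevyDensity d) {Ω : Set (Rd d)} (hΩ : Bornology.IsBounded Ω) (c : ℝ) : V ν Ω :=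
  ⟨fun _ => c, measurable_const, by
    simpa [sqNorm] using ENNReal.mul_lt_top ENNReal.ofReal_lt_top hΩ.measure_lt_top⟩

/-! ### The trace space `T_ν(Ω^c)` -/

/-- Restriction of functions to `Ω^c`, as a linear map on `V_ν(Ω|ℝ^d)`. -/
def restrictCompl (ν : LevyDensity d) (Ω : Set (Rd d)) : V ν Ω →ₗ[ℝ] ((Ωᶜ : Set (Rd d)) → ℝ) where
  toFun u x := u x
  map_add' _ _ := rfl
  map_smul' _ _ := rfl

/-- The trace space `T_ν(Ω^c)` of all restrictions to `Ω^c` of elements of `V_ν(Ω|ℝ^d)`. -/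
def T (ν : LevyDensity d) (Ω : Set (Rd d)) : Type := LinearMap.range (restrictCompl ν Ω)

section Trace

variable {ν : LevyDensity d} {Ω : Set (Rd d)}

instance : AddCommGroup (T ν Ω) :=
  inferInstanceAs (AddCommGroup (LinearMap.range (restrictCompl ν Ω)))

instance : Module ℝ (T ν Ω) :=
  inferInstanceAs (Module ℝ (LinearMap.range (restrictCompl ν Ω)))

/-- The trace map `V_ν(Ω|ℝ^d) → T_ν(Ω^c)`, `u ↦ u|_{Ω^c}`. -/
def trace (ν : LevyDensity d) (Ω : Set (Rd d)) : V ν Ω →ₗ[ℝ] T ν Ω :=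
  (restrictCompl ν Ω).rangeRestrict

/-- `‖v‖ = inf {‖u‖ : u ∈ V_ν(Ω|ℝ^d), u|_{Ω^c} = v}`. -/
instance : Norm (T ν Ω) := ⟨fun v => sInf {r : ℝ | ∃ u : V ν Ω, trace ν Ω u = v ∧ ‖u‖ = r}⟩

theorem trace_surjective : Function.Surjective (trace ν Ω) :=
  LinearMap.surjective_rangeRestrict _

theorem T.norm_def (v : T ν Ω) :
    ‖v‖ = sInf {r : ℝ | ∃ u : V ν Ω, trace ν Ω u = v ∧ ‖u‖ = r} := rfl

theorem norm_trace_le (u : V ν Ω) : ‖trace ν Ω u‖ ≤ ‖u‖ :=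
  csInf_le ⟨0, by rintro _ ⟨w, -, rfl⟩; exact norm_nonneg w⟩ ⟨u, rfl, rfl⟩

theorem T.exists_lt (v : T ν Ω) {ε : ℝ} (hε : 0 < ε) :
    ∃ u : V ν Ω, trace ν Ω u = v ∧ ‖u‖ < ‖v‖ + ε := by
  obtain ⟨w, hw⟩ := trace_surjective v
  obtain ⟨_, ⟨u, hu, rfl⟩, h⟩ := Real.lt_sInf_add_pos
    (s := {r : ℝ | ∃ u : V ν Ω, trace ν Ω u = v ∧ ‖u‖ = r}) ⟨_, w, hw, rfl⟩ hε
  exact ⟨u, hu, h⟩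

theorem T.norm_smul_le' (c : ℝ) (v : T ν Ω) : ‖c • v‖ ≤ ‖c‖ * ‖v‖ := by
  refine le_of_forall_pos_le_add fun ε hε => ?_
  obtain ⟨u, hu, h⟩ := v.exists_lt (ε := ε / (‖c‖ + 1)) (by positivity)
  calc ‖c • v‖ = ‖trace ν Ω (c • u)‖ := by rw [map_smul, hu]
    _ ≤ ‖c • u‖ := norm_trace_le _
    _ = ‖c‖ * ‖u‖ := norm_smul _ _
    _ ≤ ‖c‖ * (‖v‖ + ε / (‖c‖ + 1)) := by gcongr
    _ = ‖c‖ * ‖v‖ + (‖c‖ / (‖c‖ + 1)) * ε := by ring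
    _ ≤ ‖c‖ * ‖v‖ + 1 * ε := by
      gcongr
      rw [div_le_one (by positivity)]; linarith
    _ = ‖c‖ * ‖v‖ + ε := by ring

theorem T.core : SeminormedSpace.Core ℝ (T ν Ω) where
  norm_nonneg v := Real.sInf_nonneg (by rintro _ ⟨w, -, rfl⟩; exact norm_nonneg w)
  norm_smul c v := by
    refine le_antisymm (T.norm_smul_le' c v) ?_
    rcases eq_or_ne c 0 with rfl | hc
    · rw [norm_zero, zero_mul]
      exact Real.sInf_nonneg (by rintro _ ⟨w, -, rfl⟩; exact norm_nonneg w)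
    · have h := T.norm_smul_le' c⁻¹ (c • v)
      rw [inv_smul_smul₀ hc, norm_inv] at h
      have hc' : 0 < ‖c‖ := norm_pos_iff.2 hc
      calc ‖c‖ * ‖v‖ ≤ ‖c‖ * (‖c‖⁻¹ * ‖c • v‖) := by gcongr
        _ = ‖c • v‖ := by field_simp
  norm_triangle v w := by
    refine le_of_forall_pos_le_add fun ε hε => ?_
    obtain ⟨u, hu, h⟩ := v.exists_lt (half_pos hε)
    obtain ⟨u', hu', h'⟩ := w.exists_lt (half_pos hε)
    calc ‖v + w‖ = ‖trace ν Ω (u + u')‖ := by rw [map_add, hu, hu']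
      _ ≤ ‖u + u'‖ := norm_trace_le _
      _ ≤ ‖u‖ + ‖u'‖ := norm_add_le _ _
      _ ≤ ‖v‖ + ‖w‖ + ε := by linarith

instance : SeminormedAddCommGroup (T ν Ω) := SeminormedAddCommGroup.ofCore T.core

instance : NormedSpace ℝ (T ν Ω) where
  norm_smul_le c v := (T.core.norm_smul c v).le

end Trace

/-! ### The classes `𝒜₀, …, 𝒜₃` (for bounded open `Ω`) -/

/-- Condition (I): `∫ ν(h) dh = ∞`. -/
def LevyDensity.NonIntegrable (ν : LevyDensity d) : Prop := ∫⁻ h, ν h = ∞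

/-- `∂Ω` is Lipschitz: near every boundary point, `Ω` is, in suitable orthonormal coordinates,
the strict epigraph `{γ(x') < x_d}` of a Lipschitz function `γ`. Here `e` is the direction of the
last coordinate and `x' = x - ⟪e, x⟫ e` is the projection to the hyperplane orthogonal to `e`. -/
def HasLipschitzBoundary (Ω : Set (Rd d)) : Prop :=
  ∀ a ∈ frontier Ω, ∃ r > (0 : ℝ), ∃ e : Rd d, ‖e‖ = 1 ∧
    ∃ (K : ℝ≥0) (γ : Rd d → ℝ), LipschitzWith K γ ∧
      Ω ∩ Metric.ball a r =
        {x | γ (x - inner ℝ e x • e) < inner ℝ e x} ∩ Metric.ball a r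

/-- Class `𝒜₀`: `ν` is unimodal with full support. -/
def ClassA0 (ν : LevyDensity d) (_Ω : Set (Rd d)) : Prop :=
  ν.IsUnimodal ∧ ν.HasFullSupport

/-- Class `𝒜₁`: (I) holds and there is a bounded extension operator `H_ν(Ω) → H_ν(ℝ^d)`. -/
def ClassA1 (ν : LevyDensity d) (Ω : Set (Rd d)) : Prop :=
  ν.NonIntegrable ∧ ∃ (Ext : H ν Ω → H ν univ) (C : ℝ),
    ∀ u : H ν Ω, ‖Ext u‖ ≤ C * ‖u‖ ∧ Ext u =ᵐ[volume.restrict Ω] u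

/-- Class `𝒜₂`: (I) holds, `∂Ω` is Lipschitz, `ν` is radial and
`δ⁻² ∫_{B_δ(0)} |h|² ν(h) dh → ∞` as `δ → 0+`. -/
def ClassA2 (ν : LevyDensity d) (Ω : Set (Rd d)) : Prop :=
  ν.NonIntegrable ∧ HasLipschitzBoundary Ω ∧ ν.IsRadial ∧
    Tendsto (fun δ : ℝ => ENNReal.ofReal (1 / δ ^ 2) *
      ∫⁻ h in Metric.ball (0 : Rd d) δ, ENNReal.ofReal (‖h‖ ^ 2) * ν h) (𝓝[>] 0) (𝓝 ∞)

/-- Class `𝒜₃`: (I) holds and `inf_{a ∈ ∂Ω} ∫_{Ω_δ} ν(h - a) dh → ∞` as `δ → 0+`, where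
`Ω_δ = {x ∈ Ω : dist(x, ∂Ω) > δ}`. -/
def ClassA3 (ν : LevyDensity d) (Ω : Set (Rd d)) : Prop :=
  ν.NonIntegrable ∧
    Tendsto (fun δ : ℝ => ⨅ a ∈ frontier Ω,
      ∫⁻ h in {x ∈ Ω | δ < Metric.infDist x (frontier Ω)}, ν (h - a)) (𝓝[>] 0) (𝓝 ∞)

/-! ### The bilinear form and the variational problems -/

/-- `k` is a symmetric measurable kernel with `Λ⁻¹ ν(y - x) ≤ k(x, y) ≤ Λ ν(y - x)` off the
diagonal. -/
structure IsEllipticKernel (ν : LevyDensity d) (Λ : ℝ≥0) (k : Rd d → Rd d → ℝ≥0) : Prop where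
  measurable : Measurable (Function.uncurry k)
  symm : ∀ x y, k x y = k y x
  lower : ∀ x y, x ≠ y → (Λ : ℝ≥0∞)⁻¹ * ν (y - x) ≤ k x y
  upper : ∀ x y, x ≠ y → (k x y : ℝ≥0∞) ≤ Λ * ν (y - x)

/-- The integrand `(u(x) - u(y)) (v(x) - v(y)) k(x, y)` of the bilinear form. -/
def formIntegrand (k : Rd d → Rd d → ℝ≥0) (u v : Rd d → ℝ) (p : Rd d × Rd d) : ℝ :=
  (u p.1 - u p.2) * (v p.1 - v p.2) * (k p.1 p.2 : ℝ)

/-- `ℰ(u, v) = 1/2 ∬_{(Ω^c × Ω^c)^c} (u(x) - u(y)) (v(x) - v(y)) k(x, y) dx dy`. -/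
def form (k : Rd d → Rd d → ℝ≥0) (Ω : Set (Rd d)) (u v : Rd d → ℝ) : ℝ :=
  (1 / 2) * ∫ p in (Ωᶜ ×ˢ Ωᶜ)ᶜ, formIntegrand k u v p

/-- `u ∈ V_ν(Ω|ℝ^d)^⊥`, i.e. `∫_Ω u = 0`. -/
def MeanZero {ν : LevyDensity d} {Ω : Set (Rd d)} (u : V ν Ω) : Prop := ∫ x in Ω, u x = 0

/-- `ℰ(u, v) = ℓ(v)` for all `v ∈ V_ν(Ω|ℝ^d)`. -/
def Solves {ν : LevyDensity d} {Ω : Set (Rd d)} (k : Rd d → Rd d → ℝ≥0) (ℓ : V ν Ω → ℝ)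
    (u : V ν Ω) : Prop :=
  ∀ v : V ν Ω, form k Ω u v = ℓ v

/-- `ℰ(u, v) = ℓ(v)` for all `v ∈ V_ν(Ω|ℝ^d)^⊥`. -/
def SolvesPerp {ν : LevyDensity d} {Ω : Set (Rd d)} (k : Rd d → Rd d → ℝ≥0) (ℓ : V ν Ω → ℝ)
    (u : V ν Ω) : Prop :=
  ∀ v : V ν Ω, MeanZero v → form k Ω u v = ℓ v

/-- The right-hand side `v ↦ ⟨f, v⟩ + ⟨g, v|_{Ω^c}⟩` for `f ∈ V_ν(Ω|ℝ^d)'`, `g ∈ T_ν(Ω^c)'`. -/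
def dualRHS {ν : LevyDensity d} {Ω : Set (Rd d)} (f : StrongDual ℝ (V ν Ω))
    (g : StrongDual ℝ (T ν Ω)) (v : V ν Ω) : ℝ :=
  f v + g (trace ν Ω v)

/-- The right-hand side `v ↦ ∫_Ω f v + ∫_{Ω^c} g v`. -/
def dataRHS {ν : LevyDensity d} {Ω : Set (Rd d)} (f g : Rd d → ℝ) (v : V ν Ω) : ℝ :=
  (∫ x in Ω, f x * v x) + ∫ y in Ωᶜ, g y * v y

/-- The measure `ν̃⁻¹ dx` on `Ω^c`. -/
def weightMeasure (ν : LevyDensity d) (Ω B : Set (Rd d)) : Measure (Rd d) :=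
  ((volume : Measure (Rd d)).restrict Ωᶜ).withDensity fun x => (ν.tilde B x)⁻¹

/-- The `L²(μ)` norm of `f`, as a real number. -/
def normL2 (μ : Measure (Rd d)) (f : Rd d → ℝ) : ℝ := (eLpNorm f 2 μ).toReal

end NonlocalNeumann

end

noncomputable section

namespace NonlocalNeumann

variable {d : ℕ}

/-! ### A Poincaré inequality for densities of full support -/

/-! The difference map `D u = u(x) - u(y)` into `L²(k dx dy)` turns the form into half an inner
product, so the problem is a Riesz representation on the range of `D`. Two facts carry it:
coercivity of `D` on mean-zero functions, and closedness of its range. Both rest on full support of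
`ν`.

Coercivity is the Poincaré inequality `exists_poincare`. Full support yields a compact `K` with `|K|
> 0` and `ν ≥ ε > 0` on `K`. Two points `x`, `x'` of `Ω` at small distance share a set of measure at
least `|K|/2` of points `y` with `x - y, x' - y ∈ K`, and `(u(x) - u(x'))²` is averaged over these
`y`. They may lie outside `Ω`, since the energy counts every jump from `Ω` into `ℝ^d`. Finitely many
small pieces cover `Ω`, and any two pieces, however far apart, are linked directly because `∬ (1 ∧
ν(x - y))` over them is positive. Thus no chaining and no connectedness of `Ω` enter, and the
constant does not see `k`.

Closedness (`isClosed_range_diffL2`): mean-zero preimages of a convergent sequence of differences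
converge in `L²(Ω)` by coercivity. Almost every `y ∈ ℝ^d` is joined by the kernel to a good `x ∈ Ω`
(`ae_exists_of_ae_kernelMeasure`), so convergence at `x` and of the differences forces convergence
at `y`. The same argument gives uniqueness almost everywhere on `ℝ^d`, although the norm of `V` is
only a seminorm.

Riesz is then applied to `ℓ ∘ P`, with `P` the subtraction of the mean (`exists_wellPosed`).
Constants lie in the kernel of `D`, so the full problem requires `ℓ(1) = 0`; conversely that
condition says `ℓ ∘ P = ℓ`. For function data it remains to bound `∫_{Ω^c} g v` uniformly in `B`, by
a weighted Cauchy–Schwarz inequality and `lintegral_sq_mul_tilde_le`. -/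

theorem LevyDensity.HasFullSupport.lintegral_pos {ν : LevyDensity d} (hν : ν.HasFullSupport)
    {U : Set (Rd d)} (hU : IsOpen U) (hne : U.Nonempty) : 0 < ∫⁻ h in U, ν h := by
  obtain ⟨x, hx⟩ := hne
  have h : x ∈ ((volume : Measure (Rd d)).withDensity ν).support := by
    rw [hν]; exact mem_univ x
  have := (Measure.mem_support_iff_forall x).1 h U (hU.mem_nhds hx)
  rwa [withDensity_apply _ hU.measurableSet] at this

theorem LevyDensity.HasFullSupport.lintegral_sub_pos {ν : LevyDensity d} (hν : ν.HasFullSupport)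
    {U : Set (Rd d)} (hU : IsOpen U) (hne : U.Nonempty) (y : Rd d) :
    0 < ∫⁻ x in U, ν (x - y) := by
  have hmp : MeasurePreserving (fun x : Rd d => x - y) volume volume :=
    measurePreserving_sub_right volume y
  have h := hν.lintegral_pos (U := (fun x => x + y) ⁻¹' U)
    (hU.preimage (continuous_id.add continuous_const))
    (by obtain ⟨x, hx⟩ := hne; exact ⟨x - y, by simpa using hx⟩)
  have hmU : MeasurableSet ((fun x => x + y) ⁻¹' U) :=
    hU.measurableSet.preimage (measurable_id.add_const y)
  rw [← hmp.setLIntegral_comp_preimage hmU ν.measurable'] at h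
  simpa [← preimage_comp, Function.comp_def] using h

theorem LevyDensity.HasFullSupport.tilde_pos {ν : LevyDensity d} (hν : ν.HasFullSupport)
    {B : Set (Rd d)} (hB : IsOpen B) (hne : B.Nonempty) (x : Rd d) : 0 < ν.tilde B x := by
  have h := hν.lintegral_sub_pos hB hne x
  have ms : Measurable fun y => ν (y - x) := ν.measurable'.comp (measurable_id.sub_const x)
  have mμ : Measurable fun y => min 1 (ν (x - y)) :=
    measurable_const.min (ν.measurable'.comp (measurable_const.sub measurable_id))
  rw [setLIntegral_pos_iff ms] at h
  unfold LevyDensity.tilde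
  rw [setLIntegral_pos_iff mμ]
  refine h.trans_le (measure_mono (inter_subset_inter_left _ fun y hy => ?_))
  simp only [Function.mem_support] at hy ⊢
  rw [← ν.symm', neg_sub] at hy
  exact (lt_min zero_lt_one (pos_iff_ne_zero.2 hy)).ne'

theorem measurable_section {f : Rd d → Rd d → ℝ≥0∞}
    (hf : Measurable fun p : Rd d × Rd d => f p.1 p.2) (x : Rd d) : Measurable (f x) :=
  hf.comp measurable_prodMk_left

/-- The energy `∫_Ω ∫_{ℝ^d} (u(x) - u(y))² ν(x - y) dy dx`. -/
def jumpEnergy (ν : LevyDensity d) (Ω : Set (Rd d)) (u : Rd d → ℝ) : ℝ≥0∞ :=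
  ∫⁻ p in Ω ×ˢ univ, ENNReal.ofReal ((u p.1 - u p.2) ^ 2) * ν (p.1 - p.2)

/-- The squared difference `(u(x) - u(y))²`. -/
def sqDiff (u : Rd d → ℝ) (x y : Rd d) : ℝ≥0∞ := ENNReal.ofReal ((u x - u y) ^ 2)

theorem measurable_sqDiff {u : Rd d → ℝ} (hu : Measurable u) :
    Measurable (fun p : Rd d × Rd d => sqDiff u p.1 p.2) :=
  (((hu.comp measurable_fst).sub (hu.comp measurable_snd)).pow_const 2).ennreal_ofReal

theorem sqDiff_le_two (u : Rd d → ℝ) (x y z : Rd d) :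
    sqDiff u x z ≤ 2 * (sqDiff u x y + sqDiff u z y) := by
  unfold sqDiff
  rw [← ENNReal.ofReal_add (sq_nonneg _) (sq_nonneg _), show (2 : ℝ≥0∞) = ENNReal.ofReal 2 by simp,
    ← ENNReal.ofReal_mul (by norm_num)]
  exact ENNReal.ofReal_le_ofReal (by nlinarith [sq_nonneg ((u x - u y) + (u z - u y))])

theorem sqDiff_le_three (u : Rd d → ℝ) (x x' y y' : Rd d) :
    sqDiff u x' y' ≤ 3 * (sqDiff u x' x + sqDiff u x y + sqDiff u y y') := by
  unfold sqDiff
  rw [← ENNReal.ofReal_add (sq_nonneg _) (sq_nonneg _),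
    ← ENNReal.ofReal_add (by positivity) (sq_nonneg _), show (3 : ℝ≥0∞) = ENNReal.ofReal 3 by simp,
    ← ENNReal.ofReal_mul (by norm_num)]
  refine ENNReal.ofReal_le_ofReal ?_
  nlinarith [sq_nonneg ((u x' - u x) - (u x - u y)), sq_nonneg ((u x' - u x) - (u y - u y')),
    sq_nonneg ((u x - u y) - (u y - u y'))]

theorem jumpEnergy_eq (ν : LevyDensity d) (Ω : Set (Rd d)) {u : Rd d → ℝ} (hu : Measurable u) :
    jumpEnergy ν Ω u = ∫⁻ x in Ω, ∫⁻ y, sqDiff u x y * ν (x - y) := by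
  unfold jumpEnergy
  rw [Measure.volume_eq_prod, setLIntegral_prod, Measure.restrict_univ]
  · rfl
  · exact ((measurable_sqDiff hu).mul
      (ν.measurable'.comp (measurable_fst.sub measurable_snd))).aemeasurable

/-- Since `ν` is not almost everywhere zero, one of the level sets `{ν ≥ 1/(n+1)}` has positive
measure; inner regularity gives `K`. Compactness serves the continuity of translation in the next
lemma. -/
theorem LevyDensity.HasFullSupport.exists_compact [Nonempty (Fin d)] {ν : LevyDensity d}
    (hν : ν.HasFullSupport) :
    ∃ (ε : ℝ≥0∞) (K : Set (Rd d)), ε ≠ 0 ∧ ε ≠ ∞ ∧ IsCompact K ∧ volume K ≠ 0 ∧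
      ∀ h ∈ K, ε ≤ ν h := by
  have h : ∃ n : ℕ, volume {h | ((n : ℝ≥0∞) + 1)⁻¹ ≤ ν h} ≠ 0 := by
    by_contra! hcon
    have h0 : volume {h | ν h ≠ 0} = 0 := by
      refine measure_mono_null (fun h hh => ?_) (measure_iUnion_null hcon)
      obtain ⟨n, hn⟩ := ENNReal.exists_inv_nat_lt (a := ν h) hh
      refine mem_iUnion.2 ⟨n, ?_⟩
      exact (ENNReal.inv_le_inv.2 le_self_add).trans hn.le
    have := hν.lintegral_pos isOpen_univ univ_nonempty
    rw [Measure.restrict_univ, lintegral_pos_iff_support ν.measurable'] at this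
    exact this.ne' h0
  obtain ⟨n, hn⟩ := h
  obtain ⟨K, hK, hKc, hKpos⟩ := (measurableSet_le measurable_const
    ν.measurable').exists_lt_isCompact (μ := volume) (pos_iff_ne_zero.2 hn)
  exact ⟨_, K, by simp, by simp, hKc, hKpos.ne', hK⟩

open scoped Pointwise in
-- Translation is continuous in measure: `|(z + K) \ K| → 0` as `z → 0`. With `z = x - x'`, the set
-- in question is the reflection `x - ((z + K) ∩ K)`.
theorem exists_measure_inter_translate_ge {K : Set (Rd d)} (hK : IsCompact K)
    (h0 : volume K ≠ 0) :
    ∃ r > 0, ∀ x x' : Rd d, dist x x' < r →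
      volume K / 2 ≤ volume {y | x - y ∈ K ∧ x' - y ∈ K} := by
  have ht := tendsto_measure_vadd_sdiff_isCompact_isClosed (μ := (volume : Measure (Rd d)))
    hK hK.isClosed
  have hlt : ∀ᶠ z in 𝓝 (0 : Rd d), volume ((z +ᵥ K) \ K) < volume K / 2 :=
    ht.eventually_lt_const (ENNReal.half_pos h0)
  obtain ⟨r, hr, hball⟩ := Metric.eventually_nhds_iff.1 hlt
  refine ⟨r, hr, fun x x' hxx => ?_⟩
  have hz := hball (y := x - x') (by rwa [dist_zero_right, ← dist_eq_norm])
  have hmp : MeasurePreserving (fun y : Rd d => x - y) volume volume :=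
    Measure.measurePreserving_sub_left volume x
  have hset : {y | x - y ∈ K ∧ x' - y ∈ K} = (fun y => x - y) ⁻¹' (((x - x') +ᵥ K) ∩ K) := by
    ext y
    simp only [mem_ofPred_eq, mem_preimage, mem_inter_iff, mem_vadd_set_iff_neg_vadd_mem,
      vadd_eq_add]
    rw [and_comm, show -(x - x') + (x - y) = x' - y by abel]
  have hKm := hK.measurableSet
  have hKm' : MeasurableSet ((x - x') +ᵥ K) := (hK.vadd _).measurableSet
  rw [hset, hmp.measure_preimage (hKm'.inter hKm).nullMeasurableSet]
  have hsum := measure_inter_add_sdiff (μ := volume) ((x - x') +ᵥ K) hKm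
  rw [measure_vadd] at hsum
  have h2 : volume K ≤ volume (((x - x') +ᵥ K) ∩ K) + volume K / 2 := by
    rw [← hsum]; gcongr
    rw [hsum]; exact hz.le
  have hfin : volume K / 2 ≠ ∞ := (ENNReal.div_lt_top hK.measure_lt_top.ne (by simp)).ne
  refine (ENNReal.add_le_add_iff_right hfin).1 ?_
  rwa [ENNReal.add_halves]

theorem lintegral_const_mul_add_two {α : Type*} [MeasurableSpace α] (μ : Measure α) (c : ℝ≥0∞)
    {f g : α → ℝ≥0∞} (hf : Measurable f) (hg : Measurable g) :
    ∫⁻ x, c * (f x + g x) ∂μ = c * (∫⁻ x, f x ∂μ + ∫⁻ x, g x ∂μ) := by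
  rw [← lintegral_add_left hf]
  exact lintegral_const_mul _ (hf.add hg)

theorem lintegral_const_mul_add_three {α : Type*} [MeasurableSpace α] (μ : Measure α) (c : ℝ≥0∞)
    {f g h : α → ℝ≥0∞} (hf : Measurable f) (hg : Measurable g) (hh : Measurable h) :
    ∫⁻ x, c * (f x + g x + h x) ∂μ = c * (∫⁻ x, f x ∂μ + ∫⁻ x, g x ∂μ + ∫⁻ x, h x ∂μ) := by
  rw [← lintegral_add_left hf]
  exact lintegral_const_mul_add_two μ c (hf.add hg) hh

theorem lintegral_lintegral_const_mul_add_three {S S' : Set (Rd d)} (c a b b' : ℝ≥0∞)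
    {G G' : Rd d → ℝ≥0∞} (q : Rd d → Rd d → ℝ≥0∞) (hG : Measurable G) (hG' : Measurable G')
    (hq : Measurable fun p : Rd d × Rd d => q p.1 p.2) :
    ∫⁻ x in S, ∫⁻ y in S', c * (a * G x + b * q x y + b' * G' y) =
      c * (a * volume S' * (∫⁻ x in S, G x) + b * (∫⁻ x in S, ∫⁻ y in S', q x y) +
        b' * volume S * ∫⁻ y in S', G' y) := by
  have hin : ∀ x, ∫⁻ y in S', c * (a * G x + b * q x y + b' * G' y) =
      c * (a * volume S' * G x + b * (∫⁻ y in S', q x y) + b' * ∫⁻ y in S', G' y) := by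
    intro x
    have m1 : Measurable (q x) := measurable_section hq x
    rw [lintegral_const_mul_add_three _ _ measurable_const (m1.const_mul _)
      (hG'.const_mul _), lintegral_const_mul _ m1, lintegral_const_mul _ hG']
    simp only [lintegral_const, Measure.restrict_apply_univ]
    ring
  simp_rw [hin]
  have m1 : Measurable fun x => ∫⁻ y in S', q x y := hq.lintegral_prod_right'
  rw [lintegral_const_mul_add_three _ _ (hG.const_mul _) (m1.const_mul _)
    measurable_const, lintegral_const_mul _ m1, lintegral_const_mul _ hG]
  simp only [lintegral_const, Measure.restrict_apply_univ]
  ring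

/-- The energy controls squared differences over sets of small diameter: two nearby points of `Ω`
have many common points to which both of them jump. -/
theorem exists_poincare_small [Nonempty (Fin d)] {ν : LevyDensity d} (hν : ν.HasFullSupport)
    {Ω : Set (Rd d)} (hΩ : volume Ω ≠ ∞) :
    ∃ r > 0, ∃ C : ℝ≥0∞, C ≠ ∞ ∧ ∀ S : Set (Rd d), MeasurableSet S → S ⊆ Ω →
      (∀ x ∈ S, ∀ x' ∈ S, dist x x' < r) → ∀ u : Rd d → ℝ, Measurable u →
        ∫⁻ x in S, ∫⁻ x' in S, sqDiff u x x' ≤ C * jumpEnergy ν Ω u := by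
  obtain ⟨ε, K, hε, hε', hK, hK0, hKε⟩ := hν.exists_compact
  obtain ⟨r, hr, hrK⟩ := exists_measure_inter_translate_ge hK hK0
  have hK2 : volume K / 2 ≠ 0 := (ENNReal.half_pos hK0).ne'
  have hK2' : volume K / 2 ≠ ∞ := (ENNReal.div_lt_top hK.measure_lt_top.ne (by simp)).ne
  -- The inner factor 2 counts the two terms `F x` and `F x'`, the outer one comes from
  -- `sqDiff_le_two`; `volume Ω` bounds the integral over the idle variable.
  refine ⟨r, hr, (volume K / 2)⁻¹ * (2 * (2 * (volume Ω * ε⁻¹))), ?_,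
    fun S hS hSΩ hdiam u hu => ?_⟩
  · finiteness
  have hq := measurable_sqDiff hu
  have hνm : Measurable fun p : Rd d × Rd d => ν (p.1 - p.2) :=
    ν.measurable'.comp (measurable_fst.sub measurable_snd)
  set F : Rd d → ℝ≥0∞ := fun x => ∫⁻ y, sqDiff u x y * ν (x - y) with hF
  have hFm : Measurable F := (hq.mul hνm).lintegral_prod_right'
  have hFE : ∫⁻ x in S, F x ≤ jumpEnergy ν Ω u := by
    rw [jumpEnergy_eq ν Ω hu]; exact lintegral_mono_set hSΩ
  have hpt : ∀ x ∈ S, ∀ x' ∈ S,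
      sqDiff u x x' ≤ (volume K / 2)⁻¹ * (2 * (ε⁻¹ * (F x + F x'))) := by
    intro x hx x' hx'
    set A : Set (Rd d) := {y | x - y ∈ K ∧ x' - y ∈ K}
    have hAm : MeasurableSet A :=
      (hK.measurableSet.preimage (measurable_const.sub measurable_id)).inter
        (hK.measurableSet.preimage (measurable_const.sub measurable_id))
    have hle : ∀ y ∈ A, sqDiff u x x' ≤
        2 * (ε⁻¹ * (sqDiff u x y * ν (x - y) + sqDiff u x' y * ν (x' - y))) := by
      intro y hy
      refine (sqDiff_le_two u x y x').trans ?_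
      gcongr
      have e1 : ∀ t : ℝ≥0∞, ∀ n : ℝ≥0∞, ε ≤ n → t ≤ ε⁻¹ * (t * n) := by
        intro t n hn
        calc t = ε⁻¹ * (t * ε) := by
              rw [mul_comm t, ← mul_assoc, ENNReal.inv_mul_cancel hε hε', one_mul]
          _ ≤ _ := by gcongr
      rw [mul_add]
      exact add_le_add (e1 _ _ (hKε _ hy.1)) (e1 _ _ (hKε _ hy.2))
    -- Integrating the bound over the common landing points `y ∈ A` replaces the `y`-dependence by
    -- the total energies `F x` and `F x'`.
    have h1 : sqDiff u x x' * volume A ≤ 2 * (ε⁻¹ * (F x + F x')) := by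
      have hm : ∀ x : Rd d, Measurable fun y => sqDiff u x y * ν (x - y) := fun x =>
        measurable_section (f := fun x y => sqDiff u x y * ν (x - y)) (hq.mul hνm) x
      calc sqDiff u x x' * volume A = ∫⁻ _ in A, sqDiff u x x' := by simp
        _ ≤ ∫⁻ y in A, 2 * (ε⁻¹ * (sqDiff u x y * ν (x - y) + sqDiff u x' y * ν (x' - y))) :=
          setLIntegral_mono' hAm hle
        _ ≤ ∫⁻ y, 2 * (ε⁻¹ * (sqDiff u x y * ν (x - y) + sqDiff u x' y * ν (x' - y))) :=
          setLIntegral_le_lintegral _ _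
        _ = _ := by
          simp_rw [← mul_assoc]
          rw [lintegral_const_mul_add_two _ _ (hm x) (hm x')]
    rw [← ENNReal.mul_le_iff_le_inv hK2 hK2', mul_comm]
    exact le_trans (by gcongr; exact hrK x x' (hdiam x hx x' hx')) h1
  calc ∫⁻ x in S, ∫⁻ x' in S, sqDiff u x x'
      ≤ ∫⁻ x in S, ∫⁻ x' in S, (volume K / 2)⁻¹ * (2 * (ε⁻¹ * (F x + F x'))) :=
        setLIntegral_mono' hS fun x hx => setLIntegral_mono' hS fun x' hx' => hpt x hx x' hx'
    _ = (volume K / 2)⁻¹ * (2 * (ε⁻¹ * (2 * (volume S * ∫⁻ x in S, F x)))) := by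
        have hin : ∀ x, ∫⁻ x' in S, (volume K / 2)⁻¹ * (2 * (ε⁻¹ * (F x + F x'))) =
            (volume K / 2)⁻¹ * (2 * (ε⁻¹ * (F x * volume S + ∫⁻ x in S, F x))) := by
          intro x
          simp_rw [← mul_assoc]
          rw [lintegral_const_mul_add_two _ _ measurable_const hFm]
          simp
        simp_rw [hin, ← mul_assoc]
        rw [lintegral_const_mul_add_two _ _ (hFm.mul_const _) measurable_const,
          lintegral_mul_const _ hFm]
        simp only [lintegral_const, Measure.restrict_apply_univ]
        ring
    _ ≤ (volume K / 2)⁻¹ * (2 * (ε⁻¹ * (2 * (volume Ω * jumpEnergy ν Ω u)))) := by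
        gcongr
    _ = _ := by ring

/-- Squared differences between two open sets are controlled by those within each of them. -/
theorem exists_poincare_cross {ν : LevyDensity d} (hν : ν.HasFullSupport)
    {Ω S S' : Set (Rd d)} (hS : IsOpen S) (hS' : IsOpen S') (hΩ : volume Ω ≠ ∞)
    (hSΩ : S ⊆ Ω) (hSΩ' : S' ⊆ Ω) {C : ℝ≥0∞} (hC : C ≠ ∞) :
    ∃ C' : ℝ≥0∞, C' ≠ ∞ ∧ ∀ u : Rd d → ℝ, Measurable u →
      ∫⁻ x in S, ∫⁻ x' in S, sqDiff u x x' ≤ C * jumpEnergy ν Ω u →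
      ∫⁻ x in S', ∫⁻ x' in S', sqDiff u x x' ≤ C * jumpEnergy ν Ω u →
      ∫⁻ x in S, ∫⁻ x' in S', sqDiff u x x' ≤ C' * jumpEnergy ν Ω u := by
  rcases S.eq_empty_or_nonempty with rfl | hne
  · exact ⟨0, by simp, fun u _ _ _ => by simp⟩
  rcases S'.eq_empty_or_nonempty with rfl | hne'
  · exact ⟨0, by simp, fun u _ _ _ => by simp⟩
  -- Truncation at 1 makes the coupling mass `m` finite, while full support keeps it positive.
  set μ : Rd d → Rd d → ℝ≥0∞ := fun x y => min 1 (ν (x - y)) with hμ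
  have hμm : Measurable fun p : Rd d × Rd d => μ p.1 p.2 :=
    measurable_const.min (ν.measurable'.comp (measurable_fst.sub measurable_snd))
  set m : ℝ≥0∞ := ∫⁻ x in S, ∫⁻ y in S', μ x y with hm
  have hμ1 : ∀ x y, μ x y ≤ 1 := fun x y => min_le_left _ _
  have hSf : volume S ≠ ∞ := ne_top_of_le_ne_top hΩ (measure_mono hSΩ)
  have hSf' : volume S' ≠ ∞ := ne_top_of_le_ne_top hΩ (measure_mono hSΩ')
  have hmtop : m ≠ ∞ := by
    refine ne_top_of_le_ne_top (ENNReal.mul_ne_top hSf' hSf) (b := volume S' * volume S) ?_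
    calc m ≤ ∫⁻ x in S, ∫⁻ y in S', 1 := lintegral_mono fun x => lintegral_mono fun y => hμ1 x y
      _ = _ := by simp
  have hm0 : m ≠ 0 := by
    have hinner : ∀ x, 0 < ∫⁻ y in S', μ x y := fun x => hν.tilde_pos hS' hne' x
    have hmeas : Measurable fun x => ∫⁻ y in S', μ x y := hμm.lintegral_prod_right'
    refine ((setLIntegral_pos_iff hmeas).2 ?_).ne'
    have : (Function.support fun x => ∫⁻ y in S', μ x y) = univ :=
      eq_univ_of_forall fun x => (hinner x).ne'
    rw [this, univ_inter]
    exact hS.measure_pos _ hne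
  refine ⟨m⁻¹ * (3 * (volume S' * volume S' * C + volume S * volume S' + volume S * volume S * C)),
    by finiteness, fun u hu h h' => ?_⟩
  have hq := measurable_sqDiff hu
  have hE : ∫⁻ x in S, ∫⁻ y in S', sqDiff u x y * μ x y ≤ jumpEnergy ν Ω u := by
    rw [jumpEnergy_eq ν Ω hu]
    calc _ ≤ ∫⁻ x in S, ∫⁻ y, sqDiff u x y * ν (x - y) := by
          refine lintegral_mono fun x => ?_
          refine le_trans ?_ (setLIntegral_le_lintegral S' _)
          gcongr
          exact min_le_right _ _
      _ ≤ _ := lintegral_mono_set hSΩ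
  set Q : ℝ≥0∞ := ∫⁻ x in S, ∫⁻ x' in S', sqDiff u x x'
  have hqx : ∀ x, Measurable (sqDiff u x) := measurable_section hq
  have hqy : ∀ y, Measurable fun x => sqDiff u x y := fun y => hq.comp measurable_prodMk_right
  set G : Rd d → ℝ≥0∞ := fun x => ∫⁻ x' in S, sqDiff u x' x
  set G' : Rd d → ℝ≥0∞ := fun y => ∫⁻ y' in S', sqDiff u y y'
  have hGm : Measurable G := hq.lintegral_prod_left'
  have hGm' : Measurable G' := hq.lintegral_prod_right'
  -- Follow the path `x' → x → y → y'` and integrate over `x'` and `y'`. The weight `μ ≤ 1` is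
  -- dropped from the two inner differences and kept on the jump `x → y`, where the energy controls
  -- it. Integrating over `(x, y)` then puts `Q * m` on the left.
  have hpt : ∀ x y, Q * μ x y ≤
      3 * (volume S' * G x + volume S * volume S' * (sqDiff u x y * μ x y) + volume S * G' y) := by
    intro x y
    have h1 : Q ≤ 3 * (volume S' * G x + volume S * volume S' * sqDiff u x y + volume S * G' y) := by
      calc Q ≤ ∫⁻ x' in S, ∫⁻ y' in S', 3 * (sqDiff u x' x + sqDiff u x y + sqDiff u y y') := by
            refine lintegral_mono fun x' => lintegral_mono fun y' => sqDiff_le_three u x x' y y'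
        _ = ∫⁻ x' in S, 3 * (sqDiff u x' x * volume S' + sqDiff u x y * volume S' + G' y) := by
            refine lintegral_congr fun x' => ?_
            rw [lintegral_const_mul_add_three _ _ measurable_const measurable_const (hqx y)]
            simp [G']
        _ = _ := by
            have m1 : Measurable fun x' => sqDiff u x' x * volume S' := (hqy x).mul_const _
            rw [lintegral_const_mul_add_three _ _ m1 measurable_const measurable_const,
              lintegral_mul_const _ (hqy x)]
            simp only [lintegral_const, Measure.restrict_apply_univ]
            ring
    have e1 : ∀ a : ℝ≥0∞, a * μ x y ≤ a := fun a => mul_le_of_le_one_right' (hμ1 x y)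
    calc Q * μ x y ≤ 3 * (volume S' * G x + volume S * volume S' * sqDiff u x y +
          volume S * G' y) * μ x y := by gcongr
      _ = 3 * (volume S' * G x * μ x y + volume S * volume S' * (sqDiff u x y * μ x y) +
          volume S * G' y * μ x y) := by ring
      _ ≤ _ := by
          gcongr 3 * (?_ + _ + ?_)
          · exact e1 _
          · exact e1 _
  have hswap : ∫⁻ x in S, G x = ∫⁻ x in S, ∫⁻ x' in S, sqDiff u x x' :=
    lintegral_lintegral_swap (hq.comp measurable_swap).aemeasurable
  rw [← hswap] at h
  clear_value G G' Q μ
  have hfin : Q * m ≤ 3 * (volume S' * volume S' * C + volume S * volume S' +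
      volume S * volume S * C) * jumpEnergy ν Ω u := by
    have hqμ : Measurable fun p : Rd d × Rd d => sqDiff u p.1 p.2 * μ p.1 p.2 := hq.mul hμm
    calc Q * m = ∫⁻ x in S, ∫⁻ y in S', Q * μ x y := by
          have : ∀ x, ∫⁻ y in S', Q * μ x y = Q * ∫⁻ y in S', μ x y := fun x =>
            lintegral_const_mul _ (measurable_section hμm x)
          simp_rw [this]
          rw [lintegral_const_mul _ hμm.lintegral_prod_right']
      _ ≤ ∫⁻ x in S, ∫⁻ y in S', 3 * (volume S' * G x +
            volume S * volume S' * (sqDiff u x y * μ x y) + volume S * G' y) :=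
          lintegral_mono fun x => lintegral_mono fun y => hpt x y
      _ = 3 * (volume S' * volume S' * (∫⁻ x in S, G x) +
            volume S * volume S' * (∫⁻ x in S, ∫⁻ y in S', sqDiff u x y * μ x y) +
              volume S * volume S * ∫⁻ y in S', G' y) :=
          lintegral_lintegral_const_mul_add_three _ _ _ _ _ hGm hGm' hqμ
      _ ≤ 3 * (volume S' * volume S' * (C * jumpEnergy ν Ω u) +
            volume S * volume S' * jumpEnergy ν Ω u +
              volume S * volume S * (C * jumpEnergy ν Ω u)) := by
          gcongr
      _ = _ := by ring
  rw [mul_assoc, ← ENNReal.mul_le_iff_le_inv hm0 hmtop, mul_comm]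
  exact hfin

/-- The Poincaré inequality on a bounded open set, for a density of full support. -/
theorem exists_poincare [Nonempty (Fin d)] {ν : LevyDensity d} (hν : ν.HasFullSupport)
    {Ω : Set (Rd d)} (hΩo : IsOpen Ω) (hΩb : Bornology.IsBounded Ω) :
    ∃ C : ℝ≥0∞, C ≠ ∞ ∧ ∀ u : Rd d → ℝ, Measurable u →
      ∫⁻ x in Ω, ∫⁻ y in Ω, sqDiff u x y ≤ C * jumpEnergy ν Ω u := by
  have hvol : volume Ω ≠ ∞ := hΩb.measure_lt_top.ne
  obtain ⟨r, hr, C, hC, hsmall⟩ := exists_poincare_small hν hvol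
  obtain ⟨t, ht, hcov⟩ := Metric.totallyBounded_iff.1
    (hΩb.isCompact_closure.totallyBounded.subset subset_closure) (r / 2) (half_pos hr)
  let S : t → Set (Rd d) := fun c => Ω ∩ Metric.ball (c : Rd d) (r / 2)
  have hSo : ∀ c, IsOpen (S c) := fun c => hΩo.inter Metric.isOpen_ball
  have hSΩ : ∀ c, S c ⊆ Ω := fun c => inter_subset_left
  have hdiag : ∀ c, ∀ u : Rd d → ℝ, Measurable u →
      ∫⁻ x in S c, ∫⁻ x' in S c, sqDiff u x x' ≤ C * jumpEnergy ν Ω u := fun c =>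
    hsmall (S c) (hSo c).measurableSet (hSΩ c) fun x hx x' hx' => by
      have h1 := Metric.mem_ball.1 hx.2
      have h2 := Metric.mem_ball'.1 hx'.2
      linarith [dist_triangle x (c : Rd d) x']
  have hcross := fun c c' : t =>
    exists_poincare_cross hν (hSo c) (hSo c') hvol (hSΩ c) (hSΩ c') hC
  choose D hD hDle using hcross
  have : Fintype t := ht.fintype
  have hΩS : Ω ⊆ ⋃ c : t, S c := fun x hx => by
    obtain ⟨c, hc, hxc⟩ := mem_iUnion₂.1 (hcov hx)
    exact mem_iUnion.2 ⟨⟨c, hc⟩, hx, hxc⟩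
  refine ⟨∑ c, ∑ c', D c c', ENNReal.sum_ne_top.2 fun c _ => ENNReal.sum_ne_top.2 fun c' _ =>
    hD c c', fun u hu => ?_⟩
  have hsum : ∀ f : Rd d → ℝ≥0∞, ∫⁻ x in Ω, f x ≤ ∑ c, ∫⁻ x in S c, f x := fun f =>
    (lintegral_mono_set hΩS).trans ((lintegral_iUnion_le _ _).trans_eq (tsum_fintype _))
  calc ∫⁻ x in Ω, ∫⁻ y in Ω, sqDiff u x y
      ≤ ∑ c, ∫⁻ x in S c, ∑ c', ∫⁻ y in S c', sqDiff u x y :=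
        (hsum _).trans (Finset.sum_le_sum fun c _ => lintegral_mono fun x => hsum _)
    _ = ∑ c, ∑ c', ∫⁻ x in S c, ∫⁻ y in S c', sqDiff u x y :=
        Finset.sum_congr rfl fun c _ => lintegral_finsetSum _ fun c' _ =>
          (measurable_sqDiff hu).lintegral_prod_right'
    _ ≤ ∑ c, ∑ c', D c c' * jumpEnergy ν Ω u :=
        Finset.sum_le_sum fun c _ => Finset.sum_le_sum fun c' _ =>
          hDle c c' u hu (hdiag c u hu) (hdiag c' u hu)
    _ = _ := by simp_rw [← Finset.sum_mul]

/-! ### Subtraction of the mean -/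

section Center

variable {ν : LevyDensity d} {Ω : Set (Rd d)}

theorem integrableOn_V (hΩb : Bornology.IsBounded Ω) (u : V ν Ω) : IntegrableOn u Ω := by
  have : IsFiniteMeasure ((volume : Measure (Rd d)).restrict Ω) :=
    ⟨by simpa using hΩb.measure_lt_top⟩
  exact u.memLp.integrable (by norm_num)

theorem constV_apply (hΩb : Bornology.IsBounded Ω) (c : ℝ) (x : Rd d) :
    constV ν hΩb c x = c := rfl

/-- `u ↦ u - |Ω|⁻¹ ∫_Ω u`, as a linear map. -/
def center (ν : LevyDensity d) (hΩb : Bornology.IsBounded Ω) : V ν Ω →ₗ[ℝ] V ν Ω where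
  toFun u := u - constV ν hΩb (⨍ x in Ω, u x)
  map_add' u v := by
    refine Subtype.ext (funext fun x => ?_)
    change (u x + v x) - (⨍ x in Ω, (u x + v x)) =
      (u x - ⨍ x in Ω, u x) + (v x - ⨍ x in Ω, v x)
    rw [setAverage_eq, setAverage_eq, setAverage_eq,
      integral_add (integrableOn_V hΩb u) (integrableOn_V hΩb v), smul_add]
    ring
  map_smul' c u := by
    refine Subtype.ext (funext fun x => ?_)
    change c * u x - (⨍ x in Ω, c * u x) = c * (u x - ⨍ x in Ω, u x)
    rw [setAverage_eq, setAverage_eq, integral_const_mul, smul_eq_mul, smul_eq_mul]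
    ring

theorem center_apply (hΩb : Bornology.IsBounded Ω) (u : V ν Ω) :
    center ν hΩb u = u - constV ν hΩb (⨍ x in Ω, u x) := rfl

theorem meanZero_center (hΩo : IsOpen Ω) (hΩb : Bornology.IsBounded Ω) (hne : Ω.Nonempty)
    (u : V ν Ω) : MeanZero (center ν hΩb u) := by
  change ∫ x in Ω, (u x - ⨍ x in Ω, u x) = 0
  have hpos : volume.real Ω ≠ 0 :=
    (ENNReal.toReal_pos (hΩo.measure_pos _ hne).ne' hΩb.measure_lt_top.ne).ne'
  rw [integral_sub (integrableOn_V hΩb u) (integrableOn_const hΩb.measure_lt_top.ne),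
    setIntegral_const, setAverage_eq, smul_eq_mul, smul_eq_mul, mul_inv_cancel_left₀ hpos, sub_self]

theorem MeanZero.center_eq (hΩb : Bornology.IsBounded Ω) {u : V ν Ω} (hu : MeanZero u) :
    center ν hΩb u = u := by
  refine Subtype.ext (funext fun x => ?_)
  change u x - ⨍ x in Ω, u x = u x
  rw [setAverage_eq, show ∫ x in Ω, u x = 0 from hu, smul_zero, sub_zero]

theorem MeanZero.sub (hΩb : Bornology.IsBounded Ω) {u v : V ν Ω} (hu : MeanZero u)
    (hv : MeanZero v) : MeanZero (u - v) := by
  change ∫ x in Ω, (u x - v x) = 0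
  rw [integral_sub (integrableOn_V hΩb u) (integrableOn_V hΩb v),
    show ∫ x in Ω, u x = 0 from hu, show ∫ x in Ω, v x = 0 from hv, sub_zero]

/-- Expand the square: the cross term vanishes because the mean is zero, leaving `|Ω| u(x)² + ∫_Ω
u²`, whose second term is dropped. -/
theorem MeanZero.measure_mul_lintegral_le (hΩb : Bornology.IsBounded Ω)
    {u : V ν Ω} (hu : MeanZero u) :
    volume Ω * ∫⁻ x in Ω, ENNReal.ofReal (u x ^ 2) ≤ ∫⁻ x in Ω, ∫⁻ y in Ω, sqDiff u x y := by
  rw [← lintegral_const_mul _ (u.measurable.pow_const 2).ennreal_ofReal]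
  refine lintegral_mono fun x => ?_
  have hi := integrableOn_V hΩb u
  have hi2 : IntegrableOn (fun y => u y ^ 2) Ω := u.memLp.integrable_sq
  have hc : ∀ c : ℝ, IntegrableOn (fun _ : Rd d => c) Ω := fun c =>
    integrableOn_const hΩb.measure_lt_top.ne
  have hexp : ∀ y, (u x - u y) ^ 2 = u x ^ 2 - 2 * u x * u y + u y ^ 2 := fun y => by ring
  have hlin : IntegrableOn (fun y => u x ^ 2 - 2 * u x * u y) Ω := (hc _).sub (hi.const_mul _)
  have hint : IntegrableOn (fun y => (u x - u y) ^ 2) Ω := by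
    simp_rw [hexp]
    exact hlin.add hi2
  change _ ≤ ∫⁻ y in Ω, ENNReal.ofReal ((u x - u y) ^ 2)
  rw [← ofReal_integral_eq_lintegral_ofReal hint (ae_of_all _ fun y => sq_nonneg _),
    ← ENNReal.ofReal_toReal hΩb.measure_lt_top.ne, ← ENNReal.ofReal_mul ENNReal.toReal_nonneg]
  refine ENNReal.ofReal_le_ofReal ?_
  simp_rw [hexp]
  rw [integral_add hlin hi2, integral_sub (hc _) (hi.const_mul _),
    integral_const_mul, show ∫ x in Ω, u x = 0 from hu, setIntegral_const, smul_eq_mul]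
  have : 0 ≤ ∫ y in Ω, u y ^ 2 := integral_nonneg fun y => sq_nonneg _
  simp only [Measure.real]
  linarith

end Center

theorem exists_sqNorm_le_jumpEnergy [Nonempty (Fin d)] {ν : LevyDensity d}
    (hν : ν.HasFullSupport) {Ω : Set (Rd d)} (hΩo : IsOpen Ω) (hΩb : Bornology.IsBounded Ω)
    (hne : Ω.Nonempty) :
    ∃ C : ℝ≥0∞, C ≠ ∞ ∧ ∀ u : V ν Ω, MeanZero u → sqNorm ν Ω univ u ≤ C * jumpEnergy ν Ω u := by
  obtain ⟨C, hC, h⟩ := exists_poincare hν hΩo hΩb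
  have hv0 : volume Ω ≠ 0 := (hΩo.measure_pos _ hne).ne'
  have hv1 : volume Ω ≠ ∞ := hΩb.measure_lt_top.ne
  refine ⟨(volume Ω)⁻¹ * C + 1, by finiteness, fun u hu => ?_⟩
  have h1 := (hu.measure_mul_lintegral_le hΩb).trans (h u u.measurable)
  rw [ENNReal.mul_le_iff_le_inv hv0 hv1, ← mul_assoc] at h1
  rw [add_mul, one_mul]
  exact add_le_add h1 le_rfl

/-! ### The form as an inner product -/

/-- The measure `k(x, y) dx dy` on `(Ω^c × Ω^c)^c`. -/
def kernelMeasure (k : Rd d → Rd d → ℝ≥0) (Ω : Set (Rd d)) : Measure (Rd d × Rd d) :=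
  ((volume : Measure (Rd d × Rd d)).restrict (Ωᶜ ×ˢ Ωᶜ)ᶜ).withDensity
    fun p => ((Function.uncurry k p : ℝ≥0) : ℝ≥0∞)

section Kernel

variable {ν : LevyDensity d} {Ω : Set (Rd d)} {Λ : ℝ≥0} {k : Rd d → Rd d → ℝ≥0}

theorem lintegral_kernelMeasure (hk : IsEllipticKernel ν Λ k) {f : Rd d × Rd d → ℝ≥0∞}
    (hf : Measurable f) : ∫⁻ p, f p ∂(kernelMeasure k Ω) =
      ∫⁻ p in (Ωᶜ ×ˢ Ωᶜ)ᶜ, f p * ((Function.uncurry k p : ℝ≥0) : ℝ≥0∞) := by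
  rw [kernelMeasure, lintegral_withDensity_eq_lintegral_mul _ hk.measurable.coe_nnreal_ennreal hf]
  simp only [Pi.mul_apply, mul_comm]

theorem prod_univ_subset_compl (Ω : Set (Rd d)) : Ω ×ˢ univ ⊆ (Ωᶜ ×ˢ Ωᶜ)ᶜ :=
  fun _ hp hp' => hp'.1 hp.1

theorem IsEllipticKernel.le_mul (hk : IsEllipticKernel ν Λ k) (hΛ : 1 ≤ Λ) {x y : Rd d}
    (h : x ≠ y) : ν (x - y) ≤ Λ * k x y := by
  have h1 := hk.lower x y h
  have hΛ0 : (Λ : ℝ≥0∞) ≠ 0 := by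
    simpa using (zero_lt_one.trans_le hΛ).ne'
  rw [← ν.symm', neg_sub] at h1
  calc ν (x - y) = Λ * ((Λ : ℝ≥0∞)⁻¹ * ν (x - y)) := by
        rw [← mul_assoc, ENNReal.mul_inv_cancel hΛ0 ENNReal.coe_ne_top, one_mul]
    _ ≤ _ := by gcongr

/-- The ellipticity bounds fail to speak only on the diagonal, where the squared difference vanishes
anyway. -/
theorem jumpEnergy_le_kernel (hk : IsEllipticKernel ν Λ k) (hΛ : 1 ≤ Λ) {u : Rd d → ℝ}
    (hu : Measurable u) :
    jumpEnergy ν Ω u ≤ Λ * ∫⁻ p, sqDiff u p.1 p.2 ∂(kernelMeasure k Ω) := by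
  rw [lintegral_kernelMeasure hk (measurable_sqDiff hu),
    ← lintegral_const_mul' _ _ ENNReal.coe_ne_top]
  refine (lintegral_mono fun p => ?_).trans (lintegral_mono_set (prod_univ_subset_compl Ω))
  by_cases h : p.1 = p.2
  · simp [h]
  · change sqDiff u p.1 p.2 * ν (p.1 - p.2) ≤ Λ * (sqDiff u p.1 p.2 * k p.1 p.2)
    calc _ ≤ sqDiff u p.1 p.2 * (Λ * k p.1 p.2) := by gcongr; exact hk.le_mul hΛ h
      _ = _ := by ring

theorem sqDiff_comm (u : Rd d → ℝ) (x y : Rd d) : sqDiff u x y = sqDiff u y x := by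
  unfold sqDiff; congr 1; ring

/-- The domain of the form is the union of `Ω × ℝ^d` and `ℝ^d × Ω`, which carry equal energy by
symmetry of `ν`; hence the factor 2. -/
theorem kernel_le_jumpEnergy (hk : IsEllipticKernel ν Λ k) (hΩo : IsOpen Ω) {u : Rd d → ℝ}
    (hu : Measurable u) :
    ∫⁻ p, sqDiff u p.1 p.2 ∂(kernelMeasure k Ω) ≤ 2 * Λ * jumpEnergy ν Ω u := by
  rw [lintegral_kernelMeasure hk (measurable_sqDiff hu)]
  set f : Rd d × Rd d → ℝ≥0∞ := fun p => sqDiff u p.1 p.2 * ν (p.1 - p.2) with hf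
  have hfm : Measurable f := (measurable_sqDiff hu).mul
    (ν.measurable'.comp (measurable_fst.sub measurable_snd))
  have hswap : ∫⁻ p in univ ×ˢ Ω, f p = ∫⁻ p in Ω ×ˢ univ, f p := by
    have hmp : MeasurePreserving (Prod.swap : Rd d × Rd d → Rd d × Rd d) volume volume :=
      Measure.measurePreserving_swap
    rw [← hmp.setLIntegral_comp_preimage (hΩo.measurableSet.prod MeasurableSet.univ) hfm]
    have : (Prod.swap : Rd d × Rd d → Rd d × Rd d) ⁻¹' (Ω ×ˢ univ) = univ ×ˢ Ω :=
      preimage_swap_prod _ _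
    rw [this]
    refine lintegral_congr fun p => ?_
    simp only [hf, Prod.fst_swap, Prod.snd_swap]
    rw [sqDiff_comm, ← ν.symm', neg_sub]
  have hsub : (Ωᶜ ×ˢ Ωᶜ)ᶜ ⊆ (Ω ×ˢ univ : Set (Rd d × Rd d)) ∪ univ ×ˢ Ω := by
    intro p hp
    by_contra hcon
    simp only [mem_union, mem_prod, mem_univ, and_true, true_and, not_or] at hcon
    exact hp hcon
  calc _ ≤ ∫⁻ p in (Ωᶜ ×ˢ Ωᶜ)ᶜ, Λ * f p := by
        refine lintegral_mono fun p => ?_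
        by_cases h : p.1 = p.2
        · simp [h, sqDiff]
        · have := hk.upper p.1 p.2 h
          rw [← ν.symm', neg_sub] at this
          calc _ ≤ sqDiff u p.1 p.2 * (Λ * ν (p.1 - p.2)) := by gcongr; exact this
            _ = _ := by simp only [hf]; ring
    _ = Λ * ∫⁻ p in (Ωᶜ ×ˢ Ωᶜ)ᶜ, f p := lintegral_const_mul _ hfm
    _ ≤ Λ * ((∫⁻ p in Ω ×ˢ univ, f p) + ∫⁻ p in univ ×ˢ Ω, f p) := by
        exact mul_le_mul_right ((lintegral_mono_set hsub).trans (lintegral_union_le _ _ _)) _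
    _ = _ := by
        rw [hswap, ← two_mul]
        change _ * (2 * jumpEnergy ν Ω u) = _
        ring

theorem measurable_diff {u : Rd d → ℝ} (hu : Measurable u) :
    Measurable fun p : Rd d × Rd d => u p.1 - u p.2 :=
  (hu.comp measurable_fst).sub (hu.comp measurable_snd)

theorem jumpEnergy_lt_top (u : V ν Ω) : jumpEnergy ν Ω u < ∞ :=
  (ENNReal.add_lt_top.1 u.2.2).2

theorem memLp_diff (hk : IsEllipticKernel ν Λ k) (hΩo : IsOpen Ω) (u : V ν Ω) :
    MemLp (fun p : Rd d × Rd d => u p.1 - u p.2) 2 (kernelMeasure k Ω) := by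
  refine ⟨(measurable_diff u.measurable).aestronglyMeasurable, ?_⟩
  have h : eLpNorm (fun p : Rd d × Rd d => u p.1 - u p.2) 2 (kernelMeasure k Ω) ^ 2 < ∞ := by
    rw [eLpNorm_two_sq]
    refine (kernel_le_jumpEnergy hk hΩo u.measurable).trans_lt ?_
    exact ENNReal.mul_lt_top (by finiteness) (jumpEnergy_lt_top u)
  simpa [ENNReal.pow_lt_top_iff] using h

/-- The map `u ↦ u(x) - u(y)` into `L²(k(x, y) dx dy)`. -/
def diffL2 (hk : IsEllipticKernel ν Λ k) (hΩo : IsOpen Ω) :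
    V ν Ω →ₗ[ℝ] Lp ℝ 2 (kernelMeasure k Ω) where
  toFun u := (memLp_diff hk hΩo u).toLp fun p : Rd d × Rd d => u p.1 - u p.2
  map_add' u v := by
    rw [← MemLp.toLp_add]
    refine MemLp.toLp_congr _ _ (ae_of_all _ fun p => ?_)
    change (u p.1 + v p.1) - (u p.2 + v p.2) = (u p.1 - u p.2) + (v p.1 - v p.2)
    ring
  map_smul' c u := by
    rw [RingHom.id_apply, ← MemLp.toLp_const_smul]
    refine MemLp.toLp_congr _ _ (ae_of_all _ fun p => ?_)
    change c * u p.1 - c * u p.2 = c * (u p.1 - u p.2)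
    ring

theorem diffL2_coeFn (hk : IsEllipticKernel ν Λ k) (hΩo : IsOpen Ω) (u : V ν Ω) :
    diffL2 hk hΩo u =ᵐ[kernelMeasure k Ω] fun p => u p.1 - u p.2 :=
  MemLp.coeFn_toLp (memLp_diff hk hΩo u)

theorem diffL2_center (hk : IsEllipticKernel ν Λ k) (hΩo : IsOpen Ω)
    (hΩb : Bornology.IsBounded Ω) (u : V ν Ω) :
    diffL2 hk hΩo (center ν hΩb u) = diffL2 hk hΩo u := by
  refine MemLp.toLp_congr (memLp_diff hk hΩo _) (memLp_diff hk hΩo u) (ae_of_all _ fun p => ?_)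
  change (u p.1 - ⨍ x in Ω, u x) - (u p.2 - ⨍ x in Ω, u x) = u p.1 - u p.2
  ring

theorem norm_diffL2_sq (hk : IsEllipticKernel ν Λ k) (hΩo : IsOpen Ω) (u : V ν Ω) :
    ENNReal.ofReal (‖diffL2 hk hΩo u‖ ^ 2) = ∫⁻ p, sqDiff u p.1 p.2 ∂(kernelMeasure k Ω) := by
  have h : ‖diffL2 hk hΩo u‖ = (eLpNorm (fun p : Rd d × Rd d => u p.1 - u p.2) 2
    (kernelMeasure k Ω)).toReal := Lp.norm_toLp _ (memLp_diff hk hΩo u)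
  rw [h, ENNReal.ofReal_pow ENNReal.toReal_nonneg,
    ENNReal.ofReal_toReal (memLp_diff hk hΩo u).2.ne, eLpNorm_two_sq]
  rfl

theorem integrableOn_formIntegrand (hk : IsEllipticKernel ν Λ k) (hΩo : IsOpen Ω) (u v : V ν Ω) :
    IntegrableOn (formIntegrand k u v) (Ωᶜ ×ˢ Ωᶜ)ᶜ := by
  have h : Integrable (fun p : Rd d × Rd d => (u p.1 - u p.2) * (v p.1 - v p.2))
      (kernelMeasure k Ω) := (memLp_diff hk hΩo u).integrable_mul (memLp_diff hk hΩo v)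
  rw [kernelMeasure, integrable_withDensity_iff_integrable_smul hk.measurable] at h
  refine h.congr (ae_of_all _ fun p => ?_)
  simp only [formIntegrand, NNReal.smul_def, smul_eq_mul, Function.uncurry]
  ring

theorem inner_diffL2 (hk : IsEllipticKernel ν Λ k) (hΩo : IsOpen Ω) (u v : V ν Ω) :
    inner ℝ (diffL2 hk hΩo u) (diffL2 hk hΩo v) = 2 * form k Ω u v := by
  have h : inner ℝ (diffL2 hk hΩo u) (diffL2 hk hΩo v) =
      ∫ p, (u p.1 - u p.2) * (v p.1 - v p.2) ∂(kernelMeasure k Ω) := by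
    rw [L2.inner_def]
    refine integral_congr_ae ?_
    filter_upwards [diffL2_coeFn hk hΩo u, diffL2_coeFn hk hΩo v] with p h1 h2
    rw [h1, h2]
    simp [mul_comm]
  rw [h, kernelMeasure, integral_withDensity_eq_integral_smul hk.measurable, form]
  rw [← mul_assoc, mul_one_div_cancel two_ne_zero, one_mul]
  refine integral_congr_ae (ae_of_all _ fun p => ?_)
  simp only [formIntegrand, NNReal.smul_def, smul_eq_mul, Function.uncurry]
  ring

theorem V_norm_sq (u : V ν Ω) : ENNReal.ofReal (‖u‖ ^ 2) = sqNorm ν Ω univ u := by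
  rw [VSpace.norm_def, Real.sq_sqrt ENNReal.toReal_nonneg, ENNReal.ofReal_toReal u.2.2.ne]

end Kernel

theorem exists_norm_le_diffL2 [Nonempty (Fin d)] {ν : LevyDensity d}
    (hν : ν.HasFullSupport) {Ω : Set (Rd d)} (hΩo : IsOpen Ω) (hΩb : Bornology.IsBounded Ω)
    (hne : Ω.Nonempty) {Λ : ℝ≥0} (hΛ : 1 ≤ Λ) :
    ∃ C : ℝ, 0 < C ∧ ∀ (k : Rd d → Rd d → ℝ≥0) (hk : IsEllipticKernel ν Λ k) (u : V ν Ω),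
      MeanZero u → ‖u‖ ≤ C * ‖diffL2 hk hΩo u‖ := by
  obtain ⟨C, hC, h⟩ := exists_sqNorm_le_jumpEnergy hν hΩo hΩb hne
  -- The constant is fixed before `k`; the `+ 1` only ensures that it is positive.
  refine ⟨√((C * Λ).toReal) + 1, by positivity, fun k hk u hu => ?_⟩
  have h1 : ENNReal.ofReal (‖u‖ ^ 2) ≤
      ENNReal.ofReal ((C * Λ).toReal * ‖diffL2 hk hΩo u‖ ^ 2) := by
    rw [V_norm_sq, ENNReal.ofReal_mul ENNReal.toReal_nonneg, norm_diffL2_sq,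
      ENNReal.ofReal_toReal (by finiteness), mul_assoc]
    refine (h u hu).trans ?_
    gcongr
    exact jumpEnergy_le_kernel hk hΛ u.measurable
  rw [ENNReal.ofReal_le_ofReal_iff (by positivity)] at h1
  have h2 := Real.sqrt_le_sqrt h1
  rw [Real.sqrt_sq (norm_nonneg _), Real.sqrt_mul ENNReal.toReal_nonneg,
    Real.sqrt_sq (norm_nonneg _)] at h2
  refine h2.trans ?_
  gcongr
  linarith

/-! ### Riesz representation on a closed range -/

/-- The closed range is a Hilbert space. The bound makes `ℓ` vanish on the kernel of `D`, so `ℓ`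
descends to a bounded functional there. No topology on `M` and no injectivity of `D` are needed. -/
theorem exists_inner_eq_of_isClosed_range {M W : Type*} [AddCommGroup M] [Module ℝ M]
    [NormedAddCommGroup W] [InnerProductSpace ℝ W] [CompleteSpace W] (D : M →ₗ[ℝ] W)
    (hD : IsClosed (LinearMap.range D : Set W)) (ℓ : M →ₗ[ℝ] ℝ) {K : ℝ}
    (h : ∀ v, |ℓ v| ≤ K * ‖D v‖) : ∃ u, ∀ v, inner ℝ (D u) (D v) = ℓ v := by
  have : CompleteSpace (LinearMap.range D) := hD.completeSpace_coe
  obtain ⟨s, hs⟩ := D.rangeRestrict.exists_rightInverse_of_surjective D.range_rangeRestrict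
  have hs' : ∀ r : LinearMap.range D, D (s r) = r := fun r =>
    congrArg Subtype.val (LinearMap.congr_fun hs r)
  let L : StrongDual ℝ (LinearMap.range D) := (ℓ.comp s).mkContinuous K fun r => by
    simpa [hs'] using h (s r)
  obtain ⟨u, hu⟩ := ((InnerProductSpace.toDual ℝ (LinearMap.range D)).symm L).2
  refine ⟨u, fun v => ?_⟩
  have h1 : inner ℝ (D u) (D v) = ℓ (s (D.rangeRestrict v)) := by
    have := InnerProductSpace.toDual_symm_apply (𝕜 := ℝ) (x := D.rangeRestrict v) (y := L)
    rw [Submodule.coe_inner, ← hu] at this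
    exact this
  -- The section `s` returns a possibly different preimage of `D v`; the difference lies in the
  -- kernel of `D`, hence in that of `ℓ`.
  have h2 := h (s (D.rangeRestrict v) - v)
  rw [map_sub D, hs', LinearMap.codRestrict_apply, sub_self, norm_zero, mul_zero] at h2
  rw [h1, ← sub_eq_zero, ← map_sub]
  exact abs_nonpos_iff.1 h2

/-! ### Kernel and closed range of the difference map -/

section Kernel

variable {ν : LevyDensity d} {Ω : Set (Rd d)} {Λ : ℝ≥0} {k : Rd d → Rd d → ℝ≥0}

theorem norm_toLp_le (u : V ν Ω) : ‖u.memLp.toLp u‖ ≤ ‖u‖ := by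
  rw [← VSpace.norm_toL2 u, WithLp.prod_norm_eq_of_L2]
  exact Real.le_sqrt_of_sq_le (le_add_of_nonneg_right (sq_nonneg _))

theorem kernelMeasure_absolutelyContinuous (k : Rd d → Rd d → ℝ≥0) (Ω : Set (Rd d)) :
    kernelMeasure k Ω ≪ (volume : Measure (Rd d)).prod volume :=
  (withDensity_absolutelyContinuous _ _).trans Measure.restrict_le_self.absolutelyContinuous

/-- If `k(x, y) ≠ 0` implies a property for almost all `(x, y) ∈ Ω × ℝ^d`, then almost every `y`
has a partner `x` with this property. -/
theorem ae_exists_of_ae_kernelMeasure [Nonempty (Fin d)] (hν : ν.HasFullSupport)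
    (hΩo : IsOpen Ω) (hne : Ω.Nonempty) (hk : IsEllipticKernel ν Λ k) {P : Rd d × Rd d → Prop}
    (hP : ∀ᵐ p ∂(kernelMeasure k Ω), P p) {Q : Rd d → Prop}
    (hQ : ∀ᵐ x ∂(volume.restrict Ω), Q x) :
    ∀ᵐ y : Rd d, ∃ x, Q x ∧ P (x, y) := by
  rw [kernelMeasure, ae_withDensity_iff hk.measurable.coe_nnreal_ennreal] at hP
  have h1 := ae_restrict_of_ae_restrict_of_subset (prod_univ_subset_compl Ω) hP
  rw [Measure.volume_eq_prod, ← Measure.prod_restrict, Measure.restrict_univ] at h1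
  have h2 := Measure.ae_ae_of_ae_prod
    (Measure.measurePreserving_swap.quasiMeasurePreserving.ae h1)
  filter_upwards [h2] with y hy
  have hpos := hν.lintegral_sub_pos hΩo hne y
  have hm : Measurable fun x => ν (x - y) := ν.measurable'.comp (measurable_id.sub_const y)
  -- For fixed `y`, the points `x ∈ Ω` with `ν(x - y) ≠ 0` have positive measure, so one of them
  -- also meets all the almost-everywhere conditions.
  have hfreq : ∃ᶠ x in ae (volume.restrict Ω), ν (x - y) ≠ 0 := by
    intro hcon
    refine hpos.ne' ((lintegral_eq_zero_iff hm).2 ?_)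
    filter_upwards [hcon] with x hx using not_not.1 hx
  have hneq : ∀ᵐ x ∂(volume.restrict Ω), x ≠ y :=
    ae_restrict_of_ae (Measure.ae_ne volume y)
  obtain ⟨x, hx, hxy, hx2, hx3⟩ := (hfreq.and_eventually (hneq.and (hy.and hQ))).exists
  refine ⟨x, hx3, hx2 ?_⟩
  have hlow := hk.lower x y hxy
  rw [← ν.symm', neg_sub] at hlow
  exact ((pos_iff_ne_zero.2 (mul_ne_zero (ENNReal.inv_ne_zero.2 ENNReal.coe_ne_top) hx)).trans_le
    hlow).ne'

/-- Coercivity gives `u = 0` almost everywhere on `Ω` only; the partner `x` of almost every `y` then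
transports this to `u(y) = u(x) = 0`. -/
theorem ae_eq_zero_of_diffL2_eq_zero [Nonempty (Fin d)] (hν : ν.HasFullSupport)
    (hΩo : IsOpen Ω) (hΩb : Bornology.IsBounded Ω) (hne : Ω.Nonempty) (hΛ : 1 ≤ Λ)
    (hk : IsEllipticKernel ν Λ k) {u : V ν Ω} (hu : MeanZero u) (h : diffL2 hk hΩo u = 0) :
    u =ᵐ[volume] 0 := by
  obtain ⟨C, hC, hpoin⟩ := exists_norm_le_diffL2 hν hΩo hΩb hne hΛ
  have h0 := (norm_toLp_le u).trans (hpoin k hk u hu)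
  rw [h, norm_zero, mul_zero, norm_le_zero_iff, Lp.eq_zero_iff_ae_eq_zero] at h0
  have h1 : ∀ᵐ x ∂(volume.restrict Ω), u x = 0 := u.memLp.coeFn_toLp.symm.trans h0
  have h2 : ∀ᵐ p ∂(kernelMeasure k Ω), u p.1 - u p.2 = 0 :=
    (diffL2_coeFn hk hΩo u).symm.trans ((Lp.eq_zero_iff_ae_eq_zero).1 h)
  filter_upwards [ae_exists_of_ae_kernelMeasure hν hΩo hne hk h2 h1] with y ⟨x, hx1, hx2⟩
  simpa [hx1] using hx2

theorem isClosed_range_diffL2 [Nonempty (Fin d)] (hν : ν.HasFullSupport)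
    (hΩo : IsOpen Ω) (hΩb : Bornology.IsBounded Ω) (hne : Ω.Nonempty) (hΛ : 1 ≤ Λ)
    (hk : IsEllipticKernel ν Λ k) :
    IsClosed (LinearMap.range (diffL2 hk hΩo) : Set (Lp ℝ 2 (kernelMeasure k Ω))) := by
  obtain ⟨C, hC, hpoin⟩ := exists_norm_le_diffL2 hν hΩo hΩb hne hΛ
  refine IsSeqClosed.isClosed fun x F hx hF => ?_
  have hx' : ∀ n, ∃ u : V ν Ω, MeanZero u ∧ diffL2 hk hΩo u = x n := fun n => by
    obtain ⟨u, hu⟩ := hx n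
    exact ⟨center ν hΩb u, meanZero_center hΩo hΩb hne u, (diffL2_center hk hΩo hΩb u).trans hu⟩
  choose u hu0 hux using hx'
  -- Coercivity applied to differences of the mean-zero preimages.
  have hcau : CauchySeq fun n => (u n).memLp.toLp (u n) := by
    rw [Metric.cauchySeq_iff]
    intro ε hε
    obtain ⟨N, hN⟩ := Metric.cauchySeq_iff.1 hF.cauchySeq (ε / C) (by positivity)
    refine ⟨N, fun m hm n hn => ?_⟩
    have h1 := norm_toLp_le (u m - u n)
    have h2 := hpoin k hk (u m - u n) ((hu0 m).sub hΩb (hu0 n))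
    have h3 := hN m hm n hn
    rw [dist_eq_norm, ← hux, ← hux, ← map_sub, lt_div_iff₀' hC] at h3
    rw [dist_eq_norm]
    exact (h1.trans h2).trans_lt h3
  obtain ⟨f, hf⟩ := cauchySeq_tendsto_of_complete hcau
  obtain ⟨ns, hns, hfae⟩ := (tendstoInMeasure_of_tendsto_Lp hf).exists_seq_tendsto_ae
  obtain ⟨ms, hms, hFae⟩ := (tendstoInMeasure_of_tendsto_Lp
    (hF.comp hns.tendsto_atTop)).exists_seq_tendsto_ae
  set w : ℕ → V ν Ω := fun n => u (ns (ms n)) with hw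
  have hwΩ : ∀ᵐ x ∂(volume.restrict Ω), Tendsto (fun n => w n x) atTop (𝓝 (f x)) := by
    have h : ∀ᵐ x ∂(volume.restrict Ω), ∀ n, (u n).memLp.toLp (u n) x = u n x :=
      ae_all_iff.2 fun n => (u n).memLp.coeFn_toLp
    filter_upwards [h, hfae] with x h1 h2
    simp only [h1] at h2
    exact h2.comp hms.tendsto_atTop
  have hwF : ∀ᵐ p ∂(kernelMeasure k Ω),
      Tendsto (fun n => w n p.1 - w n p.2) atTop (𝓝 (F p)) := by
    have h : ∀ᵐ p ∂(kernelMeasure k Ω), ∀ n, x n p = u n p.1 - u n p.2 :=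
      ae_all_iff.2 fun n => by
        rw [← hux]; exact diffL2_coeFn hk hΩo (u n)
    filter_upwards [h, hFae] with p h1 h2
    simpa only [Function.comp_apply, h1] using h2
  -- At a partner `x` both `w n x` and `w n x - w n y` converge, hence so does `w n y`, including
  -- for `y` outside `Ω`, where the norm of `V` has no `L²` term.
  have hlim : ∀ᵐ y : Rd d, ∃ l, Tendsto (fun n => w n y) atTop (𝓝 l) := by
    filter_upwards [ae_exists_of_ae_kernelMeasure hν hΩo hne hk hwF hwΩ] with y ⟨x, hx1, hx2⟩
    exact ⟨_, by simpa using hx1.sub hx2⟩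
  obtain ⟨g, hgm, hg⟩ := measurable_limit_of_tendsto_metrizable_ae
    (fun n => (w n).measurable.aemeasurable) hlim
  have hgF : F =ᵐ[kernelMeasure k Ω] fun p => g p.1 - g p.2 := by
    have h1 : ∀ᵐ p ∂((volume : Measure (Rd d)).prod (volume : Measure (Rd d))),
        Tendsto (fun n => w n p.1) atTop (𝓝 (g p.1)) :=
      Measure.quasiMeasurePreserving_fst.ae hg
    have h2 : ∀ᵐ p ∂((volume : Measure (Rd d)).prod (volume : Measure (Rd d))),
        Tendsto (fun n => w n p.2) atTop (𝓝 (g p.2)) :=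
      Measure.quasiMeasurePreserving_snd.ae hg
    have hac := kernelMeasure_absolutelyContinuous k Ω
    filter_upwards [hac.ae_le h1, hac.ae_le h2, hwF] with p hp1 hp2 hp3
    exact tendsto_nhds_unique hp3 (hp1.sub hp2)
  have hgL : MemLp g 2 (volume.restrict Ω) := by
    refine (Lp.memLp f).ae_eq ?_
    filter_upwards [hwΩ, ae_restrict_of_ae hg] with x h1 h2 using tendsto_nhds_unique h1 h2
  have hgD : MemLp (fun p : Rd d × Rd d => g p.1 - g p.2) 2 (kernelMeasure k Ω) :=
    (Lp.memLp F).ae_eq hgF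
  have hgV : sqNorm ν Ω univ g < ∞ := by
    -- The `L²(Ω)` part is inherited from the limit `f`, the jump part from `F` through the lower
    -- bound on `k`.
    refine ENNReal.add_lt_top.2 ⟨?_, ?_⟩
    · rw [← eLpNorm_two_sq]; exact ENNReal.pow_lt_top hgL.2
    · refine (jumpEnergy_le_kernel hk hΛ hgm).trans_lt (ENNReal.mul_lt_top (by finiteness) ?_)
      change ∫⁻ p : Rd d × Rd d, ENNReal.ofReal ((g p.1 - g p.2) ^ 2) ∂(kernelMeasure k Ω) < ∞
      rw [← eLpNorm_two_sq (kernelMeasure k Ω) fun p : Rd d × Rd d => g p.1 - g p.2]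
      exact ENNReal.pow_lt_top hgD.2
  refine ⟨⟨g, hgm, hgV⟩, Lp.ext ?_⟩
  exact (diffL2_coeFn hk hΩo _).trans hgF.symm

end Kernel

/-! ### The variational problem for a bounded linear functional -/

section Kernel

variable {ν : LevyDensity d} {Ω : Set (Rd d)} {Λ : ℝ≥0} {k : Rd d → Rd d → ℝ≥0}

theorem form_eq_inner (hk : IsEllipticKernel ν Λ k) (hΩo : IsOpen Ω) (u v : V ν Ω) :
    form k Ω u v = 1 / 2 * inner ℝ (diffL2 hk hΩo u) (diffL2 hk hΩo v) := by
  rw [inner_diffL2]; ring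

theorem diffL2_constV (hk : IsEllipticKernel ν Λ k) (hΩo : IsOpen Ω)
    (hΩb : Bornology.IsBounded Ω) (c : ℝ) : diffL2 hk hΩo (constV ν hΩb c) = 0 := by
  refine (Lp.eq_zero_iff_ae_eq_zero).2 ((diffL2_coeFn hk hΩo _).trans (ae_of_all _ fun p => ?_))
  exact sub_self c

theorem diffL2_congr (hk : IsEllipticKernel ν Λ k) (hΩo : IsOpen Ω) {u w : V ν Ω} {c : ℝ}
    (h : w =ᵐ[volume] fun x => u x + c) : diffL2 hk hΩo w = diffL2 hk hΩo u := by
  refine MemLp.toLp_congr (memLp_diff hk hΩo w) (memLp_diff hk hΩo u) ?_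
  filter_upwards [(kernelMeasure_absolutelyContinuous k Ω).ae_le
    (Measure.quasiMeasurePreserving_fst.ae h), (kernelMeasure_absolutelyContinuous k Ω).ae_le
    (Measure.quasiMeasurePreserving_snd.ae h)] with p h1 h2
  rw [h1, h2]
  ring

theorem constV_eq_smul (hΩb : Bornology.IsBounded Ω) (c : ℝ) :
    constV ν hΩb c = c • constV ν hΩb 1 :=
  Subtype.ext (funext fun _ => (mul_one c).symm)

/-- Well-posedness of the variational problems for the functional `ℓ`. -/
def WellPosed (k : Rd d → Rd d → ℝ≥0) (hΩb : Bornology.IsBounded Ω) (ℓ : V ν Ω → ℝ)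
    (K : ℝ) : Prop :=
  ∃ u : V ν Ω, MeanZero u ∧ SolvesPerp k ℓ u ∧
    (∀ u' : V ν Ω, MeanZero u' → SolvesPerp k ℓ u' → u' =ᵐ[volume] u) ∧
    ‖u‖ ≤ K ∧
    ((∃ w : V ν Ω, Solves k ℓ w) ↔ ℓ (constV ν hΩb 1) = 0) ∧
    (ℓ (constV ν hΩb 1) = 0 →
      ∀ w : V ν Ω, Solves k ℓ w ↔ ∃ c : ℝ, w =ᵐ[volume] fun x => u x + c) ∧
    (∀ w : V ν Ω, Solves k ℓ w → ‖w - constV ν hΩb (⨍ x in Ω, w x)‖ ≤ K)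

end Kernel

/-- Precomposition with the centering `P` makes the functional bounded by `‖D v‖`, whether or not
`ℓ` vanishes on constants. Solutions of the full problem, once centered, solve the mean-zero
problem, so its uniqueness and estimate apply to them. -/
theorem exists_wellPosed [Nonempty (Fin d)] {ν : LevyDensity d} (hν : ν.HasFullSupport)
    {Ω : Set (Rd d)} (hΩo : IsOpen Ω) (hΩb : Bornology.IsBounded Ω) (hne : Ω.Nonempty)
    {Λ : ℝ≥0} (hΛ : 1 ≤ Λ) :
    ∃ C : ℝ, 0 < C ∧ ∀ k : Rd d → Rd d → ℝ≥0, IsEllipticKernel ν Λ k →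
      ∀ (ℓ : V ν Ω →ₗ[ℝ] ℝ) (N : ℝ), 0 ≤ N → (∀ v, |ℓ v| ≤ N * ‖v‖) →
        WellPosed k hΩb ℓ (C * N) := by
  obtain ⟨C, hC, hpoin⟩ := exists_norm_le_diffL2 hν hΩo hΩb hne hΛ
  -- One `C` bounds `ℓ ∘ P` by `‖D v‖`, the other returns from `‖D u‖` to `‖u‖`; the 2 undoes the
  -- factor 1/2 in the form.
  refine ⟨C * (2 * C), by positivity, fun k hk ℓ N hN hℓ => ?_⟩
  set D := diffL2 (Ω := Ω) hk hΩo with hD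
  set P := center ν hΩb with hP
  have hDP : ∀ v, D (P v) = D v := diffL2_center hk hΩo hΩb
  have hP0 : ∀ v, MeanZero (P v) := meanZero_center hΩo hΩb hne
  have hform : ∀ u v : V ν Ω, form k Ω u v = 1 / 2 * inner ℝ (D u) (D v) :=
    form_eq_inner hk hΩo
  have hbound : ∀ v, |((2 : ℝ) • ℓ.comp P) v| ≤ (2 * C * N) * ‖D v‖ := fun v => by
    have h1 := hpoin k hk (P v) (hP0 v)
    rw [← hD, hDP] at h1
    calc |((2 : ℝ) • ℓ.comp P) v| = 2 * |ℓ (P v)| := by simp [abs_mul]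
      _ ≤ 2 * (N * (C * ‖D v‖)) := by
        gcongr
        exact (hℓ _).trans (by gcongr)
      _ = _ := by ring
  obtain ⟨u₀, hu₀⟩ := exists_inner_eq_of_isClosed_range D
    (isClosed_range_diffL2 hν hΩo hΩb hne hΛ hk) _ hbound
  have hu : ∀ v : V ν Ω, form k Ω (P u₀) v = ℓ (P v) := fun v => by
    rw [hform, hDP, hu₀]; simp
  have huniq : ∀ u' : V ν Ω, MeanZero u' → SolvesPerp k ℓ u' →
      D u' = D (P u₀) := fun u' hu' hs => by
    have h1 : inner ℝ (D (u' - P u₀)) (D (u' - P u₀)) = 0 := by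
      have hz := hu'.sub hΩb (hP0 u₀)
      have e1 := hs _ hz
      have e2 := hu (u' - P u₀)
      rw [hz.center_eq hΩb, ← e1, hform, hform] at e2
      have : inner ℝ (D u') (D (u' - P u₀)) = inner ℝ (D (P u₀)) (D (u' - P u₀)) := by linarith
      rw [map_sub D, inner_sub_left, ← map_sub D, this, sub_self]
    rw [inner_self_eq_zero, map_sub, sub_eq_zero] at h1
    exact h1
  have huniq' : ∀ u' : V ν Ω, MeanZero u' → D u' = D (P u₀) → u' =ᵐ[volume] P u₀ :=
      fun u' hu' h => by
    have hz := hu'.sub hΩb (hP0 u₀)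
    have hDz : D (u' - P u₀) = 0 := by rw [map_sub, h, sub_self]
    filter_upwards [ae_eq_zero_of_diffL2_eq_zero hν hΩo hΩb hne hΛ hk hz hDz] with x hx
    exact sub_eq_zero.1 hx
  have hsolP : ∀ w : V ν Ω, Solves k ℓ w → SolvesPerp k ℓ (P w) := fun w hw v _ => by
    rw [← hw v, hform, hform, hDP]
  have hnorm : ∀ u' : V ν Ω, MeanZero u' → SolvesPerp k ℓ u' → ‖u'‖ ≤ C * (2 * C) * N :=
      fun u' hu' hs => by
    have h1 : ‖D u'‖ ≤ 2 * C * N := by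
      -- Testing with the solution itself gives `‖D u'‖² ≤ 2 C N ‖D u'‖`, which is divided by `‖D
      -- u'‖` unless that is zero.
      have h2 := hbound u₀
      rw [← hu₀, real_inner_self_eq_norm_sq, abs_of_nonneg (sq_nonneg _), ← hDP,
        ← huniq u' hu' hs, sq] at h2
      rcases (norm_nonneg (D u')).eq_or_lt with h0 | h0
      · rw [← h0]; positivity
      · exact le_of_mul_le_mul_right h2 h0
    calc ‖u'‖ ≤ C * ‖D u'‖ := hpoin k hk u' hu'
      _ ≤ C * (2 * C * N) := by gcongr
      _ = _ := by ring
  have hperp : SolvesPerp k ℓ (P u₀) := fun v hv => by rw [hu, hv.center_eq hΩb]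
  have hℓP : ℓ (constV ν hΩb 1) = 0 → ∀ v, ℓ (P v) = ℓ v := fun h0 v => by
    rw [hP, center_apply, map_sub, constV_eq_smul, map_smul, h0, smul_zero, sub_zero]
  refine ⟨P u₀, hP0 u₀, hperp, fun u' h1 h2 => huniq' u' h1 (huniq u' h1 h2),
    hnorm _ (hP0 u₀) hperp, ⟨?_, ?_⟩, fun h0 w => ⟨fun hw => ?_, ?_⟩, fun w hw => ?_⟩
  · rintro ⟨w, hw⟩
    rw [← hw, hform, hD, diffL2_constV, inner_zero_right, mul_zero]
  · exact fun h0 => ⟨P u₀, fun v => by rw [hu, hℓP h0]⟩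
  · refine ⟨⨍ x in Ω, w x, ?_⟩
    filter_upwards [huniq' (P w) (hP0 w) (huniq (P w) (hP0 w) (hsolP w hw))] with x hx
    rw [← hx]
    exact (sub_add_cancel _ _).symm
  · rintro ⟨c, hc⟩ v
    rw [hform, diffL2_congr hk hΩo hc, ← hform, hu, hℓP h0]
  · exact hnorm (P w) (hP0 w) (hsolP w hw)

/-! ### Function data -/

/-- On the unit ball the integrand is at most 1; outside it the Lévy weight `1 ∧ |h|²` equals 1. -/
theorem LevyDensity.lintegral_min_one_lt_top (ν : LevyDensity d) : ∫⁻ h, min 1 (ν h) < ∞ := by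
  have hle : ∀ h : Rd d, min 1 (ν h) ≤
      (Metric.closedBall (0 : Rd d) 1).indicator (fun _ => 1) h +
        ENNReal.ofReal (min 1 (‖h‖ ^ 2)) * ν h := by
    intro h
    by_cases hh : ‖h‖ ≤ 1
    · rw [indicator_of_mem (by simpa using hh)]
      exact (min_le_left _ _).trans le_self_add
    · have h1 : (1 : ℝ) ≤ ‖h‖ ^ 2 := one_le_pow₀ (not_le.1 hh).le
      rw [min_eq_left h1, ENNReal.ofReal_one, one_mul]
      exact (min_le_right _ _).trans le_add_self
  refine (lintegral_mono hle).trans_lt ?_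
  rw [lintegral_add_left (measurable_const.indicator measurableSet_closedBall),
    lintegral_indicator measurableSet_closedBall]
  refine ENNReal.add_lt_top.2 ⟨?_, ν.levy'⟩
  simpa using (isCompact_closedBall (0 : Rd d) 1).measure_lt_top

section Data

variable {ν : LevyDensity d} {Ω B : Set (Rd d)}

theorem LevyDensity.measurable_tilde (ν : LevyDensity d) (B : Set (Rd d)) :
    Measurable (ν.tilde B) := by
  have h : Measurable fun p : Rd d × Rd d => min 1 (ν (p.1 - p.2)) :=
    measurable_const.min (ν.measurable'.comp (measurable_fst.sub measurable_snd))
  exact h.lintegral_prod_right'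

theorem LevyDensity.tilde_lt_top (ν : LevyDensity d) (hB : Bornology.IsBounded B) (x : Rd d) :
    ν.tilde B x < ∞ := by
  calc ν.tilde B x ≤ ∫⁻ y in B, 1 := lintegral_mono fun y => min_le_left _ _
    _ = volume B := by simp
    _ < ∞ := hB.measure_lt_top

/-- The truncation is released only on the difference, which the energy absorbs; on `v(x)²` it must
stay, since `ν` itself may have infinite mass. -/
theorem ofReal_sq_mul_le {ν : LevyDensity d} (v : Rd d → ℝ) (x y : Rd d) :
    ENNReal.ofReal (v y ^ 2) * min 1 (ν (x - y)) ≤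
      2 * (sqDiff v x y * ν (x - y) + ENNReal.ofReal (v x ^ 2) * min 1 (ν (x - y))) := by
  have h1 : ENNReal.ofReal (v y ^ 2) ≤ 2 * (sqDiff v x y + ENNReal.ofReal (v x ^ 2)) := by
    unfold sqDiff
    rw [← ENNReal.ofReal_add (sq_nonneg _) (sq_nonneg _),
      show (2 : ℝ≥0∞) = ENNReal.ofReal 2 by simp, ← ENNReal.ofReal_mul (by norm_num)]
    exact ENNReal.ofReal_le_ofReal (by nlinarith [sq_nonneg ((v x - v y) + v x)])
  calc _ ≤ 2 * (sqDiff v x y + ENNReal.ofReal (v x ^ 2)) * min 1 (ν (x - y)) := by gcongr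
    _ = 2 * (sqDiff v x y * min 1 (ν (x - y)) + ENNReal.ofReal (v x ^ 2) * min 1 (ν (x - y))) := by
      ring
    _ ≤ _ := by gcongr; exact min_le_right _ _

theorem lintegral_min_one_sub (ν : LevyDensity d) (x : Rd d) :
    ∫⁻ y, min 1 (ν (x - y)) = ∫⁻ h, min 1 (ν h) :=
  lintegral_sub_left_eq_self (μ := volume) (fun h => min 1 (ν h)) x

theorem lintegral_lintegral_sq_mul_le {v : Rd d → ℝ} (hv : Measurable v) :
    ∫⁻ x in Ω, ∫⁻ y, ENNReal.ofReal (v y ^ 2) * min 1 (ν (x - y)) ≤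
      2 * (jumpEnergy ν Ω v +
        (∫⁻ x in Ω, ENNReal.ofReal (v x ^ 2)) * ∫⁻ h, min 1 (ν h)) := by
  have hμm : Measurable fun p : Rd d × Rd d => min 1 (ν (p.1 - p.2)) :=
    measurable_const.min (ν.measurable'.comp (measurable_fst.sub measurable_snd))
  have hsq : Measurable fun y => ENNReal.ofReal (v y ^ 2) := (hv.pow_const 2).ennreal_ofReal
  have hνm : Measurable fun p : Rd d × Rd d => sqDiff v p.1 p.2 * ν (p.1 - p.2) :=
    (measurable_sqDiff hv).mul
      (ν.measurable'.comp (measurable_fst.sub measurable_snd))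
  have hin : ∀ x, ∫⁻ y, ENNReal.ofReal (v y ^ 2) * min 1 (ν (x - y)) ≤
      2 * ((∫⁻ y, sqDiff v x y * ν (x - y)) +
        ENNReal.ofReal (v x ^ 2) * ∫⁻ h, min 1 (ν h)) := by
    intro x
    have m1 : Measurable fun y => min 1 (ν (x - y)) :=
      measurable_section (f := fun x y => min 1 (ν (x - y))) hμm x
    have m2 : Measurable fun y => sqDiff v x y * ν (x - y) :=
      measurable_section (f := fun x y => sqDiff v x y * ν (x - y)) hνm x
    rw [← lintegral_min_one_sub ν x, ← lintegral_const_mul _ m1,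
      ← lintegral_const_mul_add_two _ _ m2 (m1.const_mul _)]
    exact lintegral_mono fun y => ofReal_sq_mul_le v x y
  have m3 : Measurable fun x => ∫⁻ y, sqDiff v x y * ν (x - y) :=
    hνm.lintegral_prod_right'
  rw [jumpEnergy_eq ν Ω hv, ← lintegral_mul_const _ hsq,
    ← lintegral_const_mul_add_two _ _ m3 (hsq.mul_const _)]
  exact lintegral_mono hin

/-- The weighted `L²` norm on `Ω^c` is controlled by the norm of `V_ν(Ω|ℝ^d)`, uniformly
in `B`. -/
theorem lintegral_sq_mul_tilde_le (hB : B ⊆ Ω) {v : Rd d → ℝ} (hv : Measurable v) :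
    ∫⁻ y in Ωᶜ, ENNReal.ofReal (v y ^ 2) * ν.tilde B y ≤
      2 * (1 + ∫⁻ h, min 1 (ν h)) * sqNorm ν Ω univ v := by
  have hm : Measurable fun p : Rd d × Rd d =>
      ENNReal.ofReal (v p.1 ^ 2) * min 1 (ν (p.2 - p.1)) :=
    ((hv.comp measurable_fst).pow_const 2).ennreal_ofReal.mul
      (measurable_const.min (ν.measurable'.comp (measurable_snd.sub measurable_fst)))
  -- Enlarging `B` to `Ω` here is what makes the bound independent of `B`.
  have h1 : ∫⁻ y in Ωᶜ, ENNReal.ofReal (v y ^ 2) * ν.tilde B y ≤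
      ∫⁻ y, ∫⁻ x in Ω, ENNReal.ofReal (v y ^ 2) * min 1 (ν (x - y)) := by
    refine (setLIntegral_le_lintegral _ _).trans (lintegral_mono fun y => ?_)
    rw [lintegral_const_mul' _ _ ENNReal.ofReal_ne_top]
    refine mul_le_mul_right ?_ _
    have hsymm : ∀ x, min 1 (ν (y - x)) = min 1 (ν (x - y)) := fun x => by
      rw [← ν.symm' (x - y), neg_sub]
    unfold LevyDensity.tilde
    simp_rw [hsymm]
    exact lintegral_mono_set hB
  rw [lintegral_lintegral_swap hm.aemeasurable] at h1
  refine (h1.trans (lintegral_lintegral_sq_mul_le hv)).trans ?_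
  change _ ≤ 2 * (1 + ∫⁻ h, min 1 (ν h)) *
    ((∫⁻ x in Ω, ENNReal.ofReal (v x ^ 2)) + jumpEnergy ν Ω v)
  generalize (∫⁻ x in Ω, ENNReal.ofReal (v x ^ 2)) = a
  generalize jumpEnergy ν Ω v = b
  generalize (∫⁻ h, min 1 (ν h)) = M
  calc 2 * (b + a * M) ≤ 2 * ((1 + M) * b + a * (1 + M)) := by
        gcongr
        · exact le_mul_of_one_le_left' le_self_add
        · exact le_add_self
    _ = _ := by ring

end Data

/-! ### Bounds for the data functionals -/

variable {ν : LevyDensity d} {Ω B : Set (Rd d)}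

theorem WellPosed.mono {k : Rd d → Rd d → ℝ≥0} {hΩb : Bornology.IsBounded Ω} {ℓ : V ν Ω → ℝ}
    {K K' : ℝ} (h : WellPosed k hΩb ℓ K) (hK : K ≤ K') : WellPosed k hΩb ℓ K' := by
  obtain ⟨u, h1, h2, h3, h4, h5, h6, h7⟩ := h
  exact ⟨u, h1, h2, h3, h4.trans hK, h5, h6, fun w hw => (h7 w hw).trans hK⟩

/-- A weighted Cauchy–Schwarz inequality. -/
theorem lintegral_enorm_mul_sq_le {α : Type*} [MeasurableSpace α] {μ : Measure α} {g v : α → ℝ}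
    {τ : α → ℝ≥0∞} (hg : AEMeasurable g μ) (hv : AEMeasurable v μ) (hτ : Measurable τ)
    (h0 : ∀ x, τ x ≠ 0) (hτ' : ∀ x, τ x ≠ ∞) :
    (∫⁻ x, ‖g x * v x‖ₑ ∂μ) ^ 2 ≤
      eLpNorm g 2 (μ.withDensity fun x => (τ x)⁻¹) ^ 2 *
        ∫⁻ x, ENNReal.ofReal (v x ^ 2) * τ x ∂μ := by
  have hsq : ∀ t : ℝ, ‖t‖ₑ ^ 2 = ENNReal.ofReal (t ^ 2) := fun t => by
    rw [Real.enorm_eq_ofReal_abs, ← ENNReal.ofReal_pow (abs_nonneg _), sq_abs]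
  have hhalf : ∀ a : ℝ≥0∞, (a ^ (1 / 2 : ℝ)) ^ 2 = a := fun a => by
    rw [← ENNReal.rpow_natCast, ← ENNReal.rpow_mul]; norm_num
  -- Split `1 = τ^(-1/2) τ^(1/2)` between the two factors before applying Hölder with exponents 2
  -- and 2.
  have hmul : ∀ x, ‖g x * v x‖ₑ =
      ((fun x => ‖g x‖ₑ * (τ x)⁻¹ ^ (1 / 2 : ℝ)) * fun x => ‖v x‖ₑ * τ x ^ (1 / 2 : ℝ)) x := by
    intro x
    have h1 : (τ x)⁻¹ ^ (1 / 2 : ℝ) * τ x ^ (1 / 2 : ℝ) = 1 := by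
      rw [← ENNReal.mul_rpow_of_nonneg _ _ (by norm_num), ENNReal.inv_mul_cancel (h0 x) (hτ' x),
        ENNReal.one_rpow]
    simp only [Pi.mul_apply]
    rw [enorm_mul, mul_mul_mul_comm, h1, mul_one]
  have hτi : Measurable fun x => (τ x)⁻¹ := hτ.inv
  have hH := ENNReal.lintegral_mul_le_Lp_mul_Lq μ Real.HolderConjugate.two_two
    (hg.enorm.mul (hτi.pow_const (1 / 2 : ℝ)).aemeasurable)
    (hv.enorm.mul (hτ.pow_const (1 / 2 : ℝ)).aemeasurable)
  simp_rw [hmul]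
  refine (pow_le_pow_left' hH 2).trans_eq ?_
  rw [mul_pow, hhalf, hhalf, eLpNorm_two_sq,
    lintegral_withDensity_eq_lintegral_mul_non_measurable _ hτi
      (ae_of_all _ fun x => ENNReal.inv_lt_top.2 (pos_iff_ne_zero.2 (h0 x)))]
  congr 1
  · refine lintegral_congr fun x => ?_
    simp only [Pi.mul_apply, ENNReal.rpow_ofNat]
    rw [mul_pow, hhalf, hsq, mul_comm]
  · refine lintegral_congr fun x => ?_
    simp only [Pi.mul_apply, ENNReal.rpow_ofNat]
    rw [mul_pow, hhalf, hsq]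

theorem lintegral_enorm_mul_le (hν : ν.HasFullSupport) (hΩb : Bornology.IsBounded Ω)
    (hBo : IsOpen B) (hBne : B.Nonempty) (hB : B ⊆ Ω) {g : Rd d → ℝ}
    (hg : MemLp g 2 (weightMeasure ν Ω B)) (v : V ν Ω) :
    AEStronglyMeasurable g (volume.restrict Ωᶜ) ∧
    ∫⁻ y in Ωᶜ, ‖g y * v y‖ₑ ≤ eLpNorm g 2 (weightMeasure ν Ω B) *
      ENNReal.ofReal (√(2 * (1 + ∫⁻ h, min 1 (ν h))).toReal * ‖v‖) := by
  have h0 : ∀ x, ν.tilde B x ≠ 0 := fun x => (hν.tilde_pos hBo hBne x).ne'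
  have htop : ∀ x, ν.tilde B x ≠ ∞ := fun x => (ν.tilde_lt_top (hΩb.subset hB) x).ne
  -- Measurability of `g` is given for the weighted measure; it passes to Lebesgue measure on `Ω^c`
  -- because the density `1/ν̃` never vanishes, `ν̃` being finite for bounded `B`.
  have hgm : AEStronglyMeasurable g (volume.restrict Ωᶜ) :=
    hg.1.mono_ac (withDensity_absolutelyContinuous' (ν.measurable_tilde B).inv.aemeasurable
      (ae_of_all _ fun x => ENNReal.inv_ne_zero.2 (htop x)))
  have hM := ν.lintegral_min_one_lt_top.ne
  refine ⟨hgm, ?_⟩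
  have h1 := (lintegral_enorm_mul_sq_le hgm.aemeasurable v.measurable.aemeasurable
    (ν.measurable_tilde B) h0 htop).trans
      (mul_le_mul_right (lintegral_sq_mul_tilde_le hB v.measurable) _)
  refine (ENNReal.pow_le_pow_left_iff two_ne_zero).1 (h1.trans_eq ?_)
  rw [mul_pow, ← ENNReal.ofReal_pow (by positivity), mul_pow, Real.sq_sqrt ENNReal.toReal_nonneg,
    ENNReal.ofReal_mul ENNReal.toReal_nonneg, V_norm_sq, ENNReal.ofReal_toReal (by finiteness)]
  rfl

theorem norm_setIntegral_mul_le (hν : ν.HasFullSupport) (hΩb : Bornology.IsBounded Ω)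
    (hBo : IsOpen B) (hBne : B.Nonempty) (hB : B ⊆ Ω) {g : Rd d → ℝ}
    (hg : MemLp g 2 (weightMeasure ν Ω B)) (v : V ν Ω) :
    IntegrableOn (fun y => g y * v y) Ωᶜ ∧
    |∫ y in Ωᶜ, g y * v y| ≤ √(2 * (1 + ∫⁻ h, min 1 (ν h))).toReal *
      normL2 (weightMeasure ν Ω B) g * ‖v‖ := by
  obtain ⟨hgm, hle⟩ := lintegral_enorm_mul_le hν hΩb hBo hBne hB hg v
  have hfin : eLpNorm g 2 (weightMeasure ν Ω B) *
      ENNReal.ofReal (√(2 * (1 + ∫⁻ h, min 1 (ν h))).toReal * ‖v‖) ≠ ∞ :=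
    ENNReal.mul_ne_top hg.2.ne ENNReal.ofReal_ne_top
  refine ⟨⟨hgm.mul v.measurable.aestronglyMeasurable, hle.trans_lt hfin.lt_top⟩, ?_⟩
  have h1 := (enorm_integral_le_lintegral_enorm (μ := volume.restrict Ωᶜ)
    fun y => g y * v y).trans hle
  have h2 := ENNReal.toReal_mono hfin h1
  rw [toReal_enorm, Real.norm_eq_abs, ENNReal.toReal_mul, ENNReal.toReal_ofReal (by positivity)]
    at h2
  refine h2.trans_eq ?_
  simp only [normL2]
  ring

theorem norm_setIntegral_mul_le_of_memLp {f : Rd d → ℝ} (hf : MemLp f 2 (volume.restrict Ω))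
    (v : V ν Ω) :
    IntegrableOn (fun x => f x * v x) Ω ∧
    |∫ x in Ω, f x * v x| ≤ normL2 (volume.restrict Ω) f * ‖v‖ := by
  refine ⟨hf.integrable_mul v.memLp, ?_⟩
  have h1 : ∫ x in Ω, f x * v x = inner ℝ (hf.toLp f) (v.memLp.toLp v) := by
    rw [L2.inner_def]
    refine integral_congr_ae ?_
    filter_upwards [hf.coeFn_toLp, v.memLp.coeFn_toLp] with x h1 h2
    rw [h1, h2]
    simp [mul_comm]
  rw [h1]
  refine (abs_real_inner_le_norm _ _).trans ?_
  rw [Lp.norm_toLp f hf]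
  exact mul_le_mul_of_nonneg_left (norm_toLp_le v) ENNReal.toReal_nonneg

/-- The functional `v ↦ ⟨f, v⟩ + ⟨g, v|_{Ω^c}⟩` as a linear map. -/
def dualLinear (f : StrongDual ℝ (V ν Ω)) (g : StrongDual ℝ (T ν Ω)) : V ν Ω →ₗ[ℝ] ℝ :=
  f.toLinearMap + g.toLinearMap.comp (trace ν Ω)

theorem abs_dualRHS_le (f : StrongDual ℝ (V ν Ω)) (g : StrongDual ℝ (T ν Ω)) (v : V ν Ω) :
    |dualRHS f g v| ≤ (‖f‖ + ‖g‖) * ‖v‖ := by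
  rw [add_mul]
  refine (abs_add_le _ _).trans (add_le_add (f.le_opNorm v) ?_)
  exact (g.le_opNorm _).trans (mul_le_mul_of_nonneg_left (norm_trace_le v) (norm_nonneg g))

/-- The functional `v ↦ ∫_Ω f v + ∫_{Ω^c} g v` as a linear map. -/
def dataLinear (f g : Rd d → ℝ) (hf : ∀ v : V ν Ω, IntegrableOn (fun x => f x * v x) Ω)
    (hg : ∀ v : V ν Ω, IntegrableOn (fun y => g y * v y) Ωᶜ) : V ν Ω →ₗ[ℝ] ℝ where
  toFun := dataRHS f g
  map_add' u v := by
    have h1 : ∫ x in Ω, f x * (u + v) x = (∫ x in Ω, f x * u x) + ∫ x in Ω, f x * v x := by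
      rw [← integral_add (hf u) (hf v)]
      exact integral_congr_ae (ae_of_all _ fun x => mul_add _ _ _)
    have h2 : ∫ y in Ωᶜ, g y * (u + v) y = (∫ y in Ωᶜ, g y * u y) + ∫ y in Ωᶜ, g y * v y := by
      rw [← integral_add (hg u) (hg v)]
      exact integral_congr_ae (ae_of_all _ fun x => mul_add _ _ _)
    unfold dataRHS
    rw [h1, h2]
    ring
  map_smul' c v := by
    have h1 : ∫ x in Ω, f x * (c • v) x = c * ∫ x in Ω, f x * v x := by
      rw [← integral_const_mul]
      exact integral_congr_ae (ae_of_all _ fun x => mul_left_comm _ _ _)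
    have h2 : ∫ y in Ωᶜ, g y * (c • v) y = c * ∫ y in Ωᶜ, g y * v y := by
      rw [← integral_const_mul]
      exact integral_congr_ae (ae_of_all _ fun x => mul_left_comm _ _ _)
    unfold dataRHS
    rw [h1, h2, RingHom.id_apply, smul_eq_mul, mul_add]

theorem dataRHS_one (hΩb : Bornology.IsBounded Ω) (f g : Rd d → ℝ) :
    dataRHS f g (constV ν hΩb 1) = (∫ x in Ω, f x) + ∫ y in Ωᶜ, g y := by
  simp [dataRHS, constV_apply]

end NonlocalNeumann

end

/-! ### Well-posedness for dual and function data -/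

open NonlocalNeumann in
theorem mainTheorem1 {d : ℕ} (hd : 0 < d)
    (Ω : Set (Rd d)) (hΩo : IsOpen Ω) (hΩb : Bornology.IsBounded Ω) (hΩne : Ω.Nonempty)
    (ν : LevyDensity d) (hν : ν.HasFullSupport)
    (hA : ClassA0 ν Ω ∨ ClassA1 ν Ω ∨ ClassA2 ν Ω ∨ ClassA3 ν Ω)
    (Λ : ℝ≥0) (hΛ : 1 ≤ Λ) :
    ∃ C : ℝ, 0 < C ∧ ∀ k : Rd d → Rd d → ℝ≥0, IsEllipticKernel ν Λ k →
      (∀ u v : V ν Ω, IntegrableOn (formIntegrand k u v) (Ωᶜ ×ˢ Ωᶜ)ᶜ) ∧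
      -- data in the dual spaces
      (∀ (f : StrongDual ℝ (V ν Ω)) (g : StrongDual ℝ (T ν Ω)),
        ∃ u : V ν Ω, MeanZero u ∧ SolvesPerp k (dualRHS f g) u ∧
          (∀ u' : V ν Ω, MeanZero u' → SolvesPerp k (dualRHS f g) u' → u' =ᵐ[volume] u) ∧
          ‖u‖ ≤ C * (‖f‖ + ‖g‖) ∧
          ((∃ w : V ν Ω, Solves k (dualRHS f g) w) ↔
            f (constV ν hΩb 1) + g (trace ν Ω (constV ν hΩb 1)) = 0) ∧
          (f (constV ν hΩb 1) + g (trace ν Ω (constV ν hΩb 1)) = 0 →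
            ∀ w : V ν Ω, Solves k (dualRHS f g) w ↔ ∃ c : ℝ, w =ᵐ[volume] fun x => u x + c) ∧
          (∀ w : V ν Ω, Solves k (dualRHS f g) w →
            ‖w - constV ν hΩb (⨍ x in Ω, w x)‖ ≤ C * (‖f‖ + ‖g‖))) ∧
      -- data in `L²(Ω)` and `L²(Ω^c, ν̃⁻¹)`
      (∀ B : Set (Rd d), IsOpen B → B.Nonempty → B ⊆ Ω →
        ∀ f g : Rd d → ℝ, MemLp f 2 (volume.restrict Ω) → MemLp g 2 (weightMeasure ν Ω B) →
        (∀ v : V ν Ω, IntegrableOn (fun x => f x * v x) Ω ∧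
          IntegrableOn (fun y => g y * v y) Ωᶜ) ∧
        ∃ u : V ν Ω, MeanZero u ∧ SolvesPerp k (dataRHS f g) u ∧
          (∀ u' : V ν Ω, MeanZero u' → SolvesPerp k (dataRHS f g) u' → u' =ᵐ[volume] u) ∧
          ‖u‖ ≤ C * (normL2 (volume.restrict Ω) f + normL2 (weightMeasure ν Ω B) g) ∧
          ((∃ w : V ν Ω, Solves k (dataRHS f g) w) ↔ (∫ x in Ω, f x) + ∫ y in Ωᶜ, g y = 0) ∧
          ((∫ x in Ω, f x) + ∫ y in Ωᶜ, g y = 0 →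
            ∀ w : V ν Ω, Solves k (dataRHS f g) w ↔ ∃ c : ℝ, w =ᵐ[volume] fun x => u x + c) ∧
          (∀ w : V ν Ω, Solves k (dataRHS f g) w →
            ‖w - constV ν hΩb (⨍ x in Ω, w x)‖ ≤
              C * (normL2 (volume.restrict Ω) f + normL2 (weightMeasure ν Ω B) g))) := by
  have : Nonempty (Fin d) := ⟨⟨0, hd⟩⟩
  obtain ⟨C, hC, hwp⟩ := exists_wellPosed hν hΩo hΩb hΩne hΛ
  set c : ℝ := √(2 * (1 + ∫⁻ h, min 1 (ν h))).toReal with hc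
  have hc0 : 0 ≤ c := Real.sqrt_nonneg _
  -- Here `c` bounds the norm of `v ↦ v|_{Ω^c}` from `V` into `L²(ν̃ dx)` and depends on `ν` alone;
  -- the factor `1 + c` serves both kinds of data.
  refine ⟨C * (1 + c), by positivity, fun k hk =>
    ⟨integrableOn_formIntegrand hk hΩo, fun f g => ?_, fun B hBo hBne hB f g hf hg => ?_⟩⟩
  · refine WellPosed.mono (hwp k hk (dualLinear f g) (‖f‖ + ‖g‖) (by positivity)
      (abs_dualRHS_le f g)) ?_
    rw [mul_assoc]
    exact mul_le_mul_of_nonneg_left (le_mul_of_one_le_left (by positivity) (by linarith)) hC.le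
  · have hfI : ∀ v : V ν Ω, _ := norm_setIntegral_mul_le_of_memLp hf
    have hgI : ∀ v : V ν Ω, _ := norm_setIntegral_mul_le hν hΩb hBo hBne hB hg
    refine ⟨fun v => ⟨(hfI v).1, (hgI v).1⟩, ?_⟩
    have hf0 : 0 ≤ normL2 (volume.restrict Ω) f := ENNReal.toReal_nonneg
    have hg0 : 0 ≤ normL2 (weightMeasure ν Ω B) g := ENNReal.toReal_nonneg
    have hbd : ∀ v : V ν Ω, |dataRHS f g v| ≤
        ((1 + c) * (normL2 (volume.restrict Ω) f + normL2 (weightMeasure ν Ω B) g)) * ‖v‖ := by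
      intro v
      refine (abs_add_le _ _).trans ((add_le_add (hfI v).2 (hgI v).2).trans ?_)
      rw [← add_mul]
      refine mul_le_mul_of_nonneg_right ?_ (norm_nonneg v)
      rw [← hc]
      nlinarith [mul_nonneg hc0 hf0]
    have h := hwp k hk (dataLinear f g (fun v => (hfI v).1) fun v => (hgI v).1) _
      (by positivity) hbd
    rw [← mul_assoc] at h
    rw [← dataRHS_one (ν := ν) hΩb f g]
    exact h
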